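/- Fermionic setting. Let $n\ge 0$ and let $\mathcal H$ be the $2^n$-dimensional Fock space of $n$ fermionic sites, with creation and annihilation operators $a_i^\dagger,a_i$ ($i\in[n]=\{1,\dots,n\}$), $\{a_i^\dagger,a_j\}=\delta_{ij}$, $\{a_i,a_j\}=0$, and vacuum $|0\rangle$. For $v\in\mathbb C^n$ put $a^\dagger(v)=\sum_i v_i a_i^\dagger$ and $a(v)=\sum_i \overline{v_i}\,a_i$, and let $e_i$ be the standard basis vectors. A reduced metric is a Hermitian positive definite $n\times n$ matrix $M$; its total metric is the operator $\eta$ on $\mathcal H$ with $\eta a_i^\dagger=\sum_j M_{ji}a_j^\dagger\eta$ for all $i$ and $\eta|0\rangle=|0\rangle$. An observable is an operator $O$ with $\eta O=O^\dagger\eta$. For $S\subseteq[n]$, an operator is Bravyi–Kitaev local to $S$ if it is a linear combination of products $\prod_{i\in S_1}a_i^\dagger\prod_{j\in S_2}a_j$ with $S_1,S_2\subseteq S$ and $|S_1|+|S_2|$ even; it is extensively local over $A$ if it is local to $A$ and to no proper subset of $A$. **(1)** Let $M$ be a reduced metric and $f:[n]\to[n]$ an involution such that $M_{ij}\ne0$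 if and only if $i=f(j)$ or $i=j$ (so $M$ decomposes into $1\times1$ and $2\times2$ blocks). Then the total metric $\eta$ exists, is unique and is Hermitian positive definite, and for every $A\subseteq[n]$: (a) there is an observable extensively local over $A$ if and only if $f(A)=A$; (b) if $f(A)=A$, the observables which are Bravyi–Kitaev local to $A$ are exactly the operators $$O=\sum_{S_1,S_2\subseteq A}O_{S_1S_2}\Big(\prod_{i\in S_1}a^\dagger(e_i)\Big)\Big(\prod_{j\in S_2}a(M^{AA}e_j)\Big)$$ with complex coefficients satisfying $O_{S_1S_2}=\overline{O_{S_2S_1}}$ and $O_{S_1S_2}=0$ whenever $|S_1|+|S_2|$ is odd. Here $M^{AA}$ is the block of $M$ with rows and columns in $A$, the first product is taken in increasing and the second in decreasing order of the sites. **(2)** (Nearest-neighbour impurity model.) Let $n=2m$ with $m\ge1$ and $\bar i=n+1-i$; let $\gamma\in\mathbb C$, $\beta\in\mathbb R$, $V_i=V_{\bar i}\in\mathbb R$, and let $t_1,\dots,t_{n-1}\in\mathbb C\setminus\{0\}$ satisfy $\arg t_{n-i}=\arg t_i$ for all $i$ and $\beta^2+(\operatorname{Im}\gamma)^2<|t_m|^2$.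 Let $$H=\gamma a_m^\dagger a_m+\overline\gamma\,a_{\bar m}^\dagger a_{\bar m}+\sum_{i=1}^{n}V_ia_i^\dagger a_i+\sum_{i=1}^{n-1}\big(\overline{t_{n-i}}\,a_i^\dagger a_{i+1}+t_i\,a_{i+1}^\dagger a_i\big),$$ and let $M$ be the matrix with $M_{ij}=0$ unless $j\in\{i,\bar i\}$, with $M_{mm}=M_{\bar m\bar m}=1$, $M_{m\bar m}=\overline{M_{\bar m m}}=(\beta-i\operatorname{Im}\gamma)/t_m$, and, for $i<m$, $$M_{ii}=\frac{t_i}{t_{n-i}}M_{i+1,i+1},\qquad M_{\bar i\bar i}=\frac{t_i}{t_{n-i}}M_{n-i,n-i},\qquad M_{i\bar i}=\overline{M_{\bar ii}}=\frac{\overline{t_i}}{t_{n-i}}M_{i+1,n-i}.$$ Then $M$ is a reduced metric, it has a unique total metric $\eta$, and $H$ is an observable. If $\operatorname{Im}\gamma\ne0$ or $\beta\ne0$, then for every $A\subseteq[n]$ there is an observable extensively local over $A$ if and only if $A$ is parity symmetric, i.e. $\{\bar i:i\in A\}=A$. If $\operatorname{Im}\gamma=\beta=0$, there is an observable extensively local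 over every $A\subseteq[n]$. Everything said here, except that $H$ is an observable, also holds for the matrix obtained by inverting the fractions in the three recurrences (replacing $t_i/t_{n-i}$ by $t_{n-i}/t_i$ and $\overline{t_i}/t_{n-i}$ by $t_{n-i}/\overline{t_i}$). -/

import Mathlib

open scoped ComplexOrder

noncomputable section

namespace FreeFermion

/-- Linear operators on the fermionic Fock space over the sites `Fin n`.  The Hilbert space has an
orthonormal basis labelled by the subsets of the set of sites (the occupied sites), and operators
are written as matrices in that basis; the adjoint is the conjugate transpose. -/
abbrev Op (n : ℕ) := Matrix (Finset (Fin n)) (Finset (Fin n)) ℂ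

/-- The annihilation operator `a_i`: it sends the basis state `T` to `0` when `i ∉ T` and to
`(-1) ^ #{j ∈ T | j < i}` times the basis state `T \ {i}` when `i ∈ T`. -/
def annih {n : ℕ} (i : Fin n) : Op n :=
  Matrix.of fun S T =>
    if i ∈ T ∧ S = T.erase i then (-1 : ℂ) ^ (T.filter (fun j => j < i)).card else 0

/-- The creation operator `a†_i`, the adjoint of `a_i`. -/
def creat {n : ℕ} (i : Fin n) : Op n := (annih i).conjTranspose

/-- The vacuum state. -/
def vacuum (n : ℕ) : Finset (Fin n) → ℂ := Pi.single ∅ 1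

/-- `a(f) = ∑ i, conj (f i) a_i`. -/
def annihVec {n : ℕ} (f : Fin n → ℂ) : Op n := ∑ i, star (f i) • annih i

/-- `a†(g) = ∑ i, g i a†_i`. -/
def creatVec {n : ℕ} (g : Fin n → ℂ) : Op n := ∑ i, g i • creat i

/-- The standard basis vector `e_i` of `ℂ^n`. -/
def stdVec {n : ℕ} (i : Fin n) : Fin n → ℂ := Pi.single i 1

/-- `∏_{i ∈ S} a†(v i)`, the factors in increasing order of the sites. -/
def creatProd {n : ℕ} (v : Fin n → (Fin n → ℂ)) (S : Finset (Fin n)) : Op n :=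
  ((S.sort (fun i j => i ≤ j)).map fun i => creatVec (v i)).prod

/-- `∏_{j ∈ S} a(w j)`, the factors in decreasing order of the sites, so that
`annihProd v S` is the adjoint of `creatProd v S`. -/
def annihProd {n : ℕ} (w : Fin n → (Fin n → ℂ)) (S : Finset (Fin n)) : Op n :=
  ((S.sort (fun i j => j ≤ i)).map fun j => annihVec (w j)).prod

/-- `O` is Bravyi-Kitaev local to `S`: it is a linear combination of products of an even number of
creation and annihilation operators with indices in `S`. -/
def IsBKLocal {n : ℕ} (S : Finset (Fin n)) (O : Op n) : Prop :=
  O ∈ Submodule.span ℂ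
    {X : Op n | ∃ S₁ S₂ : Finset (Fin n), S₁ ⊆ S ∧ S₂ ⊆ S ∧ Even (S₁.card + S₂.card) ∧
      X = creatProd stdVec S₁ * annihProd stdVec S₂}

/-- `O` is extensively local over `A`: local to `A` and to no proper subset of `A`. -/
def IsExtensivelyLocal {n : ℕ} (A : Finset (Fin n)) (O : Op n) : Prop :=
  IsBKLocal A O ∧ ∀ S : Finset (Fin n), S ⊂ A → ¬ IsBKLocal S O

/-- `η` is a total metric of the reduced metric `M`: `η a†_i = ∑ j, M j i a†_j η` for all `i`,
and `η` fixes the vacuum. -/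
def IsTotalMetric {n : ℕ} (M : Matrix (Fin n) (Fin n) ℂ) (η : Op n) : Prop :=
  (∀ i, η * creat i = ∑ j, M j i • (creat j * η)) ∧ η.mulVec (vacuum n) = vacuum n

/-- Quasi-Hermitian observables of the metric `η`: `η O = O† η`. -/
def IsObservable {n : ℕ} (η O : Op n) : Prop := η * O = O.conjTranspose * η

/-- There are extensively local observables in the subsystem `A`. -/
def HasExtensivelyLocalObservable {n : ℕ} (η : Op n) (A : Finset (Fin n)) : Prop :=
  ∃ O : Op n, IsObservable η O ∧ IsExtensivelyLocal A O

/-- The block `M^{AA}`, as an operator on `ℂ^n` that vanishes off the span of the `e_i`, `i ∈ A`. -/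
def diagBlock {n : ℕ} (M : Matrix (Fin n) (Fin n) ℂ) (A : Finset (Fin n)) :
    Matrix (Fin n) (Fin n) ℂ :=
  Matrix.of fun i j => if i ∈ A ∧ j ∈ A then M i j else 0

/-- The operator `∑_{S₁, S₂ ⊆ A} c S₁ S₂ (∏_{i ∈ S₁} a†(e_i)) (∏_{j ∈ S₂} a(M^{AA} e_j))`. -/
def generalLocal {n : ℕ} (M : Matrix (Fin n) (Fin n) ℂ) (A : Finset (Fin n))
    (c : Finset (Fin n) → Finset (Fin n) → ℂ) : Op n :=
  ∑ S₁ ∈ A.powerset, ∑ S₂ ∈ A.powerset,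
    c S₁ S₂ • (creatProd stdVec S₁ *
      annihProd (fun j => (diagBlock M A).mulVec (stdVec j)) S₂)

/-! ### The nearest-neighbour impurity model on `2 * m` sites

The sites `1, …, 2m` are the elements of `Fin (2 * m)`, the site `k` being the index with value
`k - 1`; the parity `k ↦ 2m + 1 - k` is `Fin.rev`.  The hopping amplitudes `t 1, …, t (2m - 1)`
keep their numbers. -/

/-- The first-quantized Hamiltonian: on-site potential `V`, impurities `γ` and `conj γ` at the
sites `m` and `m + 1`, hopping `conj (t (2m - k)) a†_k a_{k+1} + t k a†_{k+1} a_k`. -/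
def nnGamma (m : ℕ) (t : ℕ → ℂ) (V : Fin (2 * m) → ℝ) (γ : ℂ) :
    Matrix (Fin (2 * m)) (Fin (2 * m)) ℂ :=
  Matrix.of fun i j =>
    (if i = j then (V i : ℂ) else 0)
    + (if i = j ∧ (i : ℕ) + 1 = m then γ else 0)
    + (if i = j ∧ (i : ℕ) = m then star γ else 0)
    + (if (j : ℕ) = (i : ℕ) + 1 then star (t (2 * m - ((i : ℕ) + 1))) else 0)
    + (if (i : ℕ) = (j : ℕ) + 1 then t ((j : ℕ) + 1) else 0)

/-- The Hamiltonian `∑ i j, Γ i j a†_i a_j`. -/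
def nnHamiltonian (m : ℕ) (t : ℕ → ℂ) (V : Fin (2 * m) → ℝ) (γ : ℂ) : Op (2 * m) :=
  ∑ i, ∑ j, nnGamma m t V γ i j • (creat i * annih j)

/-- Solution of the recurrence `x_m = c`, `x_k = r k * x_{k+1}` for `k < m`; the value at `d` is
`x_{m-d}`. -/
def fromCentre (m : ℕ) (r : ℕ → ℂ) (c : ℂ) : ℕ → ℂ
  | 0 => c
  | d + 1 => r (m - (d + 1)) * fromCentre m r c d

/-- The matrix of parity blocks with `M_{mm} = M_{m+1,m+1} = 1`, `M_{m,m+1} = conj M_{m+1,m} = c`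
and, for the sites `k < m` with parity images `k'`, the recurrences
`M_{kk} = r k * M_{k+1,k+1}`, `M_{k'k'} = r k * M_{k'-1,k'-1}` and
`M_{kk'} = conj M_{k'k} = s k * M_{k+1,k'-1}`. -/
def parityBlocks (m : ℕ) (r s : ℕ → ℂ) (c : ℂ) : Matrix (Fin (2 * m)) (Fin (2 * m)) ℂ :=
  Matrix.of fun i j =>
    if i = j then
      (if (i : ℕ) < m then fromCentre m r 1 (m - ((i : ℕ) + 1)) else fromCentre m r 1 ((i : ℕ) - m))
    else if i = j.rev then
      (if (i : ℕ) < m then fromCentre m s c (m - ((i : ℕ) + 1))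
        else star (fromCentre m s c ((i : ℕ) - m)))
    else 0

/-- The reduced metrics of the model, a family with the real parameter `β`. -/
def nnMetric (m : ℕ) (t : ℕ → ℂ) (γ : ℂ) (β : ℝ) : Matrix (Fin (2 * m)) (Fin (2 * m)) ℂ :=
  parityBlocks m (fun k => t k / t (2 * m - k)) (fun k => star (t k) / t (2 * m - k))
    (((β : ℂ) - Complex.I * (γ.im : ℂ)) / t m)

/-- The same recurrences with all ratios of hopping amplitudes inverted. -/
def nnMetricInv (m : ℕ) (t : ℕ → ℂ) (γ : ℂ) (β : ℝ) : Matrix (Fin (2 * m)) (Fin (2 * m)) ℂ :=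
  parityBlocks m (fun k => t (2 * m - k) / t k) (fun k => t (2 * m - k) / star (t k))
    (((β : ℂ) - Complex.I * (γ.im : ℂ)) / t m)

end FreeFermion

end

open FreeFermion

namespace FreeFermion

open Matrix

/-! ### Canonical anticommutation relations and ordered products of modes -/

section

variable {n : ℕ}

/-! Total metrics are second quantizations. An operator on Fock space is determined by its value on
the vacuum and by its exchange relations with the `creat i` (`op_ext_of_vacuum`). Hence `M` has
exactly one total metric, the operator Γ(M) that applies `M` to every mode of a product of creation
operators on the vacuum. It is multiplicative in `M` and compatible with adjoints, so M = B†B gives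
η = Γ(B)†Γ(B), which is positive definite (`IsTotalMetric.posDef`).

Locality is tested by commutation: an operator local to `A` is local to `A.erase i` once it commutes
with a_i and a†_i (`IsBKLocal.erase`). If O is an observable local to `A` and j ∉ A, then O†
commutes with a_j and a†_j, and conjugation by η turns this into commutation of O with modes in
which `M` mixes j with its partner i. If i ∈ A, then O commutes with a_i and a†_i and was not
extensively local (`IsBKLocal.erase_of_isObservable`). Conversely, if `M` does not couple `A` to its
complement, ∑ a†(e_i) a(M e_i) over `A` is an extensively local observable. For the general form, η
carries each monomial a†(e)⋯a(Me)⋯ to the adjoint of the monomial with S₁ and S₂ exchanged, so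
observability becomes Hermitian symmetry of the coefficients.

In the impurity model the recurrences preserve |M_{iī}| / M_{ii} = |c|, where c is the central
off-diagonal entry. Since |c| < 1, Gershgorin's theorem gives positivity, and the parity pairs are
coupled exactly when c ≠ 0. The Hamiltonian is an observable because `M` times its first
quantization is Hermitian (`nnMetric_mul_nnGamma`): the recurrences cancel every defect except one
from the central bond, which balances the gain and loss γ − γ̄ on the impurities. -/

/-- The Jordan-Wigner sign `(-1) ^ #{j ∈ T | j < i}`. -/
noncomputable def jwSign (i : Fin n) (T : Finset (Fin n)) : ℂ :=
  (-1) ^ (T.filter (fun j => j < i)).card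

/-- The basis state labelled by `T`. -/
noncomputable def ket (T : Finset (Fin n)) : Finset (Fin n) → ℂ := Pi.single T 1

theorem jwSign_mul_self (i : Fin n) (T : Finset (Fin n)) : jwSign i T * jwSign i T = 1 := by
  rw [jwSign, ← mul_pow]; simp

theorem jwSign_erase_self (i : Fin n) (T : Finset (Fin n)) :
    jwSign i (T.erase i) = jwSign i T := by
  simp [jwSign, Finset.filter_erase]

theorem jwSign_insert_self (i : Fin n) (T : Finset (Fin n)) :
    jwSign i (insert i T) = jwSign i T := by
  simp [jwSign, Finset.filter_insert]

theorem jwSign_insert {i j : Fin n} {T : Finset (Fin n)} (hj : j ∉ T) :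
    jwSign i (insert j T) = (if j < i then -1 else 1) * jwSign i T := by
  unfold jwSign
  rw [Finset.filter_insert]
  split_ifs with h
  · rw [Finset.card_insert_of_notMem (by simp [hj]), pow_succ]; ring
  · simp

theorem jwSign_erase {i j : Fin n} {T : Finset (Fin n)} (hj : j ∈ T) :
    jwSign i (T.erase j) = (if j < i then -1 else 1) * jwSign i T := by
  conv_rhs => rw [← Finset.insert_erase hj, jwSign_insert (Finset.notMem_erase j T)]
  split_ifs <;> ring

theorem op_ext {X Y : Op n} (h : ∀ T, X *ᵥ ket T = Y *ᵥ ket T) : X = Y :=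
  Matrix.ext_of_mulVec_single h

theorem annih_mulVec_ket (i : Fin n) (T : Finset (Fin n)) :
    annih i *ᵥ ket T = if i ∈ T then jwSign i T • ket (T.erase i) else 0 := by
  ext S
  rw [ket, Matrix.mulVec_single_one]
  by_cases hi : i ∈ T
  · by_cases hS : S = T.erase i <;> simp [annih, jwSign, ket, hi, hS]
  · simp [annih, hi]

theorem creat_mulVec_ket (i : Fin n) (T : Finset (Fin n)) :
    creat i *ᵥ ket T = if i ∈ T then 0 else jwSign i T • ket (insert i T) := by
  ext S
  rw [ket, Matrix.mulVec_single_one]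
  by_cases hi : i ∈ T
  · have : ¬ (i ∈ S ∧ T = S.erase i) := by rintro ⟨_, rfl⟩; simp at hi
    simp [creat, annih, hi, this]
  · by_cases hS : S = insert i T
    · subst hS
      have := jwSign_insert_self i T
      simp only [jwSign] at this
      simp [creat, annih, hi, jwSign, ket, this]
    · have : ¬ (i ∈ S ∧ T = S.erase i) := by
        rintro ⟨h, rfl⟩; exact hS (Finset.insert_erase h).symm
      simp [creat, annih, hi, this, ket, hS]

theorem annih_mul_creat_self (i : Fin n) : annih i * creat i + creat i * annih i = 1 := by
  refine op_ext fun T => ?_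
  rw [add_mulVec, ← mulVec_mulVec, ← mulVec_mulVec, creat_mulVec_ket, annih_mulVec_ket, one_mulVec]
  by_cases hi : i ∈ T
  · simp [hi, mulVec_smul, creat_mulVec_ket, smul_smul, jwSign_erase_self, jwSign_mul_self]
  · simp [hi, mulVec_smul, annih_mulVec_ket, smul_smul, jwSign_insert_self, jwSign_mul_self]

theorem annih_mul_creat_of_ne {i j : Fin n} (hij : i ≠ j) :
    annih i * creat j + creat j * annih i = 0 := by
  refine op_ext fun T => ?_
  rw [add_mulVec, ← mulVec_mulVec, ← mulVec_mulVec, creat_mulVec_ket, annih_mulVec_ket, zero_mulVec]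
  by_cases hi : i ∈ T <;> by_cases hj : j ∈ T
  · simp [hi, hj, mulVec_smul, creat_mulVec_ket, hij.symm]
  · simp only [hi, hj, mulVec_smul, creat_mulVec_ket, annih_mulVec_ket, smul_smul, if_true,
      if_false, Finset.mem_insert, Finset.mem_erase, or_true, and_false]
    rw [jwSign_insert hj, jwSign_erase hi, Finset.erase_insert_of_ne hij.symm, ← add_smul]
    -- Exactly one of the two Jordan-Wigner signs flips, according to which site comes first, so the
    -- two orders cancel.
    rcases lt_or_gt_of_ne hij with h | h <;> simp [h, h.not_gt] <;> left <;> ring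
  · simp [hi, hj]
  · simp [hi, hj, mulVec_smul, annih_mulVec_ket, hij]

theorem annih_mul_creat (i j : Fin n) :
    annih i * creat j + creat j * annih i = if i = j then 1 else 0 := by
  split_ifs with h
  · rw [h, annih_mul_creat_self]
  · exact annih_mul_creat_of_ne h

theorem creat_mul_creat (i j : Fin n) : creat i * creat j + creat j * creat i = 0 := by
  refine op_ext fun T => ?_
  rw [add_mulVec, ← mulVec_mulVec, ← mulVec_mulVec, creat_mulVec_ket, creat_mulVec_ket,
    zero_mulVec]
  by_cases hij : i = j
  · subst hij
    by_cases hi : i ∈ T <;> simp [hi, mulVec_smul, creat_mulVec_ket]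
  by_cases hi : i ∈ T <;> by_cases hj : j ∈ T
  · simp [hi, hj]
  · simp [hi, hj, mulVec_smul, creat_mulVec_ket]
  · simp [hi, hj, mulVec_smul, creat_mulVec_ket]
  · simp only [hi, hj, mulVec_smul, creat_mulVec_ket, smul_smul,
      if_false, Finset.mem_insert, hij, Ne.symm hij, or_self]
    rw [jwSign_insert hj, jwSign_insert hi, Finset.insert_comm, ← add_smul]
    rcases lt_or_gt_of_ne hij with h | h <;> simp [h, h.not_gt] <;> left <;> ring

theorem conjTranspose_creat (i : Fin n) : (creat i)ᴴ = annih i := conjTranspose_conjTranspose _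

theorem conjTranspose_annih (i : Fin n) : (annih i)ᴴ = creat i := rfl

theorem ket_empty : ket (∅ : Finset (Fin n)) = vacuum n := rfl

theorem annih_mulVec_vacuum (i : Fin n) : annih i *ᵥ vacuum n = 0 := by
  rw [← ket_empty, annih_mulVec_ket]; simp

theorem ket_insert {i : Fin n} {T : Finset (Fin n)} (hi : i ∉ T) :
    ket (insert i T) = jwSign i T • (creat i *ᵥ ket T) := by
  rw [creat_mulVec_ket, if_neg hi, smul_smul, jwSign_mul_self, one_smul]

/-- Operators are determined by their value on the vacuum and by exchange relations with the
creation operators. -/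
theorem op_ext_of_vacuum {X Y : Op n} (K : Fin n → Op n) (hX : ∀ i, X * creat i = K i * X)
    (hY : ∀ i, Y * creat i = K i * Y) (h : X *ᵥ vacuum n = Y *ᵥ vacuum n) : X = Y := by
  refine op_ext fun T => ?_
  induction T using Finset.induction_on with
  | empty => exact h
  | insert i T hi ih =>
    rw [ket_insert hi, mulVec_smul, mulVec_smul, mulVec_mulVec, mulVec_mulVec, hX, hY,
      ← mulVec_mulVec, ← mulVec_mulVec, ih]

theorem creatVec_mul_creatVec (v w : Fin n → ℂ) :
    creatVec v * creatVec w + creatVec w * creatVec v = 0 := by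
  have : creatVec w * creatVec v = ∑ i, ∑ j, (v i * w j) • (creat j * creat i) := by
    rw [creatVec, creatVec, Finset.sum_mul_sum, Finset.sum_comm]
    simp [smul_smul]
  rw [this, creatVec, creatVec, Finset.sum_mul_sum]
  simp only [← Finset.sum_add_distrib, smul_mul_smul_comm, ← smul_add, creat_mul_creat, smul_zero,
    Finset.sum_const_zero]

theorem creatVec_mul_self (v : Fin n → ℂ) : creatVec v * creatVec v = 0 := by
  have := creatVec_mul_creatVec v v
  rw [← two_smul ℂ] at this
  simpa using this

theorem creatVec_mul_comm (v w : Fin n → ℂ) :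
    creatVec v * creatVec w = -(creatVec w * creatVec v) :=
  eq_neg_of_add_eq_zero_left (creatVec_mul_creatVec v w)

theorem creatVec_stdVec (i : Fin n) : creatVec (stdVec i) = creat i := by
  simp [creatVec, stdVec, Pi.single_apply]

theorem annihVec_stdVec (i : Fin n) : annihVec (stdVec i) = annih i := by
  rw [annihVec, Finset.sum_eq_single i] <;> simp +contextual [stdVec]

theorem conjTranspose_creatVec (v : Fin n → ℂ) : (creatVec v)ᴴ = annihVec v := by
  simp [creatVec, annihVec, conjTranspose_sum, conjTranspose_creat]

theorem conjTranspose_annihVec (v : Fin n → ℂ) : (annihVec v)ᴴ = creatVec v := by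
  rw [← conjTranspose_creatVec, conjTranspose_conjTranspose]

theorem conjTranspose_creatProd (v : Fin n → Fin n → ℂ) (S : Finset (Fin n)) :
    (creatProd v S)ᴴ = annihProd v S := by
  have h : S.sort (fun i j => j ≤ i) = (S.sort (fun i j => i ≤ j)).reverse := by
    refine List.Perm.eq_of_pairwise' (r := fun i j : Fin n => j ≤ i) (Finset.pairwise_sort _ _) ?_ ?_
    · rw [List.pairwise_reverse]; exact Finset.pairwise_sort _ _
    · exact ((Finset.sort_perm_toList _ _).trans (Finset.sort_perm_toList _ _).symm).trans
        (List.reverse_perm _).symm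
  rw [creatProd, annihProd, h, conjTranspose_list_prod, List.map_map, List.map_reverse]
  congr 2
  simp [Function.comp_def, conjTranspose_creatVec]

theorem conjTranspose_annihProd (v : Fin n → Fin n → ℂ) (S : Finset (Fin n)) :
    (annihProd v S)ᴴ = creatProd v S := by
  rw [← conjTranspose_creatProd, conjTranspose_conjTranspose]

theorem creatProd_empty (v : Fin n → Fin n → ℂ) : creatProd v ∅ = 1 := by
  simp [creatProd]

theorem creatProd_insert_of_lt (v : Fin n → Fin n → ℂ) {a : Fin n} {S : Finset (Fin n)}
    (h : ∀ x ∈ S, a < x) : creatProd v (insert a S) = creatVec (v a) * creatProd v S := by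
  rw [creatProd, Finset.sort_insert _ (fun b hb => (h b hb).le) (fun ha => (h a ha).false)]
  simp [creatProd]

/-- Only the anticommutation of creation operators enters, so arbitrary modes obey the same sign
rule as the basis states. This is what lets `secondQuant` intertwine the two. -/
theorem creatVec_mul_creatProd (v : Fin n → Fin n → ℂ) (i : Fin n) (S : Finset (Fin n)) :
    creatVec (v i) * creatProd v S =
      if i ∈ S then 0 else jwSign i S • creatProd v (insert i S) := by
  induction S using Finset.induction_on_min with
  | empty => simp [creatProd, jwSign]
  | insert a S h ih =>
    have ha : a ∉ S := fun ha => (h a ha).false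
    rw [creatProd_insert_of_lt v h, ← mul_assoc]
    rcases lt_trichotomy i a with hia | rfl | hia
    · have h' : ∀ x ∈ insert a S, i < x := by
        intro x hx
        rcases Finset.mem_insert.1 hx with rfl | hx
        · exact hia
        · exact hia.trans (h x hx)
      rw [if_neg (fun hi => (h' i hi).false), creatProd_insert_of_lt v h',
        creatProd_insert_of_lt v h, jwSign, Finset.filter_false_of_mem]
      · simp [mul_assoc]
      · exact fun x hx => (h' x hx).not_gt
    · simp [creatVec_mul_self]
    · rw [creatVec_mul_comm, neg_mul, mul_assoc, ih, jwSign_insert ha, if_pos hia]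
      by_cases hi : i ∈ S
      · simp [hi]
      · have h' : ∀ x ∈ insert i S, a < x := by
          intro x hx
          rcases Finset.mem_insert.1 hx with rfl | hx
          · exact hia
          · exact h x hx
        rw [if_neg hi, if_neg (by simp [hi, hia.ne']), Finset.insert_comm,
          creatProd_insert_of_lt v h']
        simp

end

/-! ### Second quantization: existence, uniqueness and positivity of the total metric -/

section

variable {n : ℕ}

theorem creatProd_congr {v w : Fin n → Fin n → ℂ} {S : Finset (Fin n)}
    (h : ∀ i ∈ S, v i = w i) : creatProd v S = creatProd w S := by
  unfold creatProd
  congr 1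
  refine List.map_congr_left fun i hi => ?_
  rw [h i (by simpa using hi)]

theorem annihProd_congr {v w : Fin n → Fin n → ℂ} {S : Finset (Fin n)}
    (h : ∀ i ∈ S, v i = w i) : annihProd v S = annihProd w S := by
  rw [← conjTranspose_creatProd, ← conjTranspose_creatProd, creatProd_congr h]

theorem annih_mul_creatVec (i : Fin n) (v : Fin n → ℂ) :
    annih i * creatVec v + creatVec v * annih i = v i • 1 := by
  simp only [creatVec, Finset.mul_sum, Finset.sum_mul, ← Finset.sum_add_distrib, mul_smul_comm,
    smul_mul_assoc, ← smul_add, annih_mul_creat]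
  simp

theorem annihVec_mul_creat (w : Fin n → ℂ) (j : Fin n) :
    annihVec w * creat j + creat j * annihVec w = star (w j) • 1 := by
  simp only [annihVec, Finset.mul_sum, Finset.sum_mul, ← Finset.sum_add_distrib, mul_smul_comm,
    smul_mul_assoc, ← smul_add, annih_mul_creat]
  simp

theorem annihVec_mulVec_vacuum (w : Fin n → ℂ) : annihVec w *ᵥ vacuum n = 0 := by
  simp [annihVec, sum_mulVec, smul_mulVec, annih_mulVec_vacuum]

theorem sum_smul_creat_mul (M : Matrix (Fin n) (Fin n) ℂ) (η : Op n) (i : Fin n) :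
    ∑ j, M j i • (creat j * η) = creatVec (M *ᵥ stdVec i) * η := by
  simp [creatVec, Finset.sum_mul, stdVec]

theorem isTotalMetric_iff {M : Matrix (Fin n) (Fin n) ℂ} {η : Op n} :
    IsTotalMetric M η ↔
      (∀ i, η * creat i = creatVec (M *ᵥ stdVec i) * η) ∧ η *ᵥ vacuum n = vacuum n := by
  simp only [IsTotalMetric, sum_smul_creat_mul]

theorem sum_smul_stdVec (v : Fin n → ℂ) : ∑ i, v i • stdVec i = v := by
  ext j; simp [stdVec, Pi.single_apply]

/-- The second quantization of a matrix. -/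
noncomputable def secondQuant (M : Matrix (Fin n) (Fin n) ℂ) : Op n :=
  Matrix.of fun S T => (creatProd (fun i => M *ᵥ stdVec i) T *ᵥ vacuum n) S

theorem secondQuant_mulVec_ket (M : Matrix (Fin n) (Fin n) ℂ) (T : Finset (Fin n)) :
    secondQuant M *ᵥ ket T = creatProd (fun i => M *ᵥ stdVec i) T *ᵥ vacuum n := by
  rw [ket, mulVec_single_one]; rfl

theorem isTotalMetric_secondQuant (M : Matrix (Fin n) (Fin n) ℂ) :
    IsTotalMetric M (secondQuant M) := by
  rw [isTotalMetric_iff]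
  constructor
  · intro i
    refine op_ext fun T => ?_
    rw [← mulVec_mulVec, ← mulVec_mulVec, creat_mulVec_ket, secondQuant_mulVec_ket, mulVec_mulVec,
      creatVec_mul_creatProd (fun i => M *ᵥ stdVec i)]
    split_ifs with hi
    · simp
    · rw [mulVec_smul, secondQuant_mulVec_ket, smul_mulVec]
  · rw [← ket_empty, secondQuant_mulVec_ket, creatProd_empty, one_mulVec, ket_empty]

namespace IsTotalMetric

variable {M N : Matrix (Fin n) (Fin n) ℂ} {η ζ : Op n}

theorem unique (h : IsTotalMetric M η) (h' : IsTotalMetric M ζ) : η = ζ := by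
  rw [isTotalMetric_iff] at h h'
  exact op_ext_of_vacuum _ h.1 h'.1 (h.2.trans h'.2.symm)

theorem mul_creatVec (h : IsTotalMetric M η) (v : Fin n → ℂ) :
    η * creatVec v = creatVec (M *ᵥ v) * η := by
  rw [isTotalMetric_iff] at h
  have : creatVec (M *ᵥ v) = ∑ i, v i • creatVec (M *ᵥ stdVec i) := by
    simp only [creatVec, Finset.smul_sum, smul_smul]
    rw [Finset.sum_comm]
    simp only [← Finset.sum_smul]
    refine Finset.sum_congr rfl fun j _ => ?_
    simp [mulVec, dotProduct, stdVec, Pi.single_apply, mul_comm]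
  rw [this, creatVec, Finset.mul_sum, Finset.sum_mul]
  simp [h.1]

protected theorem mul (h : IsTotalMetric M η) (h' : IsTotalMetric N ζ) :
    IsTotalMetric (M * N) (η * ζ) := by
  rw [isTotalMetric_iff]
  constructor
  · intro i
    rw [mul_assoc, ← creatVec_stdVec, h'.mul_creatVec, ← mul_assoc, h.mul_creatVec, mul_assoc,
      mulVec_mulVec]
  · rw [← mulVec_mulVec, (isTotalMetric_iff.1 h').2, (isTotalMetric_iff.1 h).2]

protected theorem one : IsTotalMetric (1 : Matrix (Fin n) (Fin n) ℂ) 1 := by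
  simp [isTotalMetric_iff, creatVec_stdVec]

/-- The exchange relation with annihilation operators is not part of the definition. It follows from
uniqueness: both sides kill the vacuum and have the same anticommutation defect M_{ij} η with a†_j.
-/
theorem annih_mul (h : IsTotalMetric M η) (i : Fin n) :
    annih i * η = η * annihVec (Mᴴ *ᵥ stdVec i) := by
  have h1 := (isTotalMetric_iff.1 h).1
  have h2 := (isTotalMetric_iff.1 h).2
  rw [← sub_eq_zero]
  refine op_ext_of_vacuum (fun j => - creatVec (M *ᵥ stdVec j)) (fun j => ?_) (by simp) ?_
  · have e1 := annih_mul_creatVec i (M *ᵥ stdVec j)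
    have e2 := annihVec_mul_creat (Mᴴ *ᵥ stdVec i) j
    have e3 : star ((Mᴴ *ᵥ stdVec i) j) = (M *ᵥ stdVec j) i := by simp [stdVec]
    rw [e3] at e2
    rw [← eq_sub_iff_add_eq] at e1 e2
    rw [sub_mul, mul_assoc, mul_assoc, h1, ← mul_assoc, e1, e2, mul_sub, ← mul_assoc η, h1, neg_mul,
      mul_sub, sub_mul]
    simp only [mul_assoc, smul_mul_assoc, mul_smul_comm, one_mul, mul_one]
    abel
  · rw [sub_mulVec, ← mulVec_mulVec, ← mulVec_mulVec, h2, annih_mulVec_vacuum,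
      annihVec_mulVec_vacuum]
    simp

theorem conjTranspose (h : IsTotalMetric M η) : IsTotalMetric Mᴴ ηᴴ := by
  rw [isTotalMetric_iff]
  constructor
  · intro i
    have := congrArg Matrix.conjTranspose (h.annih_mul i)
    rwa [conjTranspose_mul, conjTranspose_mul, conjTranspose_annih, conjTranspose_annihVec] at this
  · refine funext fun T => ?_
    -- The adjoint fixes the vacuum because η preserves the vacuum component of every ket: on a
    -- nonempty ket, both the ket and its image start with a creation operator, whose range is
    -- orthogonal to the vacuum.
    have key : ∀ T, star (vacuum n) ⬝ᵥ (η *ᵥ ket T) = star (vacuum n) ⬝ᵥ ket T := by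
      intro T
      have hz : ∀ (v : Fin n → ℂ) (x : Finset (Fin n) → ℂ),
          star (vacuum n) ⬝ᵥ (creatVec v *ᵥ x) = 0 := by
        intro v x
        rw [dotProduct_mulVec, ← conjTranspose_annihVec, ← star_mulVec, annihVec_mulVec_vacuum]
        simp
      induction T using Finset.induction_on with
      | empty => rw [ket_empty, (isTotalMetric_iff.1 h).2]
      | insert i T hi _ =>
        rw [ket_insert hi, mulVec_smul, mulVec_mulVec, (isTotalMetric_iff.1 h).1, dotProduct_smul,
          dotProduct_smul, ← mulVec_mulVec, ← creatVec_stdVec, hz, hz]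
    have := congrArg star (key T)
    simpa [vacuum, ket, Pi.single_apply, eq_comm] using this

theorem isHermitian (h : IsTotalMetric M η) (hM : M.IsHermitian) : η.IsHermitian := by
  have := h.conjTranspose
  rw [hM.eq] at this
  exact this.unique h

theorem isUnit (h : IsTotalMetric M η) (hM : IsUnit M) : IsUnit η := by
  obtain ⟨u, rfl⟩ := hM
  have h' := isTotalMetric_secondQuant (↑u⁻¹ : Matrix (Fin n) (Fin n) ℂ)
  have e1 := h.mul h'
  have e2 := h'.mul h
  rw [Units.mul_inv] at e1
  rw [Units.inv_mul] at e2
  exact ⟨⟨η, _, e1.unique .one, e2.unique .one⟩, rfl⟩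

-- Second quantization is functorial and respects adjoints, so a factorization M = B†B with
-- invertible B lifts to η.
open scoped MatrixOrder Matrix.Norms.L2Operator in
theorem posDef (h : IsTotalMetric M η) (hM : M.PosDef) : η.PosDef := by
  obtain ⟨B, hB⟩ := CStarAlgebra.nonneg_iff_eq_star_mul_self.mp hM.posSemidef.nonneg
  have hB' : IsUnit B := by
    have := hM.isUnit
    rw [hB] at this
    rw [isUnit_iff_isUnit_det] at this ⊢
    rw [det_mul] at this
    exact isUnit_of_mul_isUnit_right this
  have h' := isTotalMetric_secondQuant B
  have e := h'.conjTranspose.mul h'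
  rw [← star_eq_conjTranspose B, ← hB] at e
  rw [h.unique e]
  exact PosDef.conjTranspose_mul_self _ (mulVec_injective_of_isUnit (h'.isUnit hB'))

end IsTotalMetric

theorem existsUnique_isTotalMetric (M : Matrix (Fin n) (Fin n) ℂ) : ∃! η : Op n, IsTotalMetric M η :=
  ⟨_, isTotalMetric_secondQuant M, fun _ h => h.unique (isTotalMetric_secondQuant M)⟩

end

section

variable {n : ℕ}

/-! ### Locality -/

theorem creatVec_mul_creatProd_comm (u : Fin n → ℂ) (v : Fin n → Fin n → ℂ)
    (S : Finset (Fin n)) :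
    creatVec u * creatProd v S = (-1 : ℂ) ^ S.card • (creatProd v S * creatVec u) := by
  induction S using Finset.induction_on_min with
  | empty => simp [creatProd_empty]
  | insert a S h ih =>
    rw [creatProd_insert_of_lt v h, ← mul_assoc, creatVec_mul_comm, neg_mul, mul_assoc, ih,
      Finset.card_insert_of_notMem (fun ha => (h a ha).false), pow_succ, mul_assoc]
    simp

theorem annih_mul_creatProd_comm {i : Fin n} {S : Finset (Fin n)} (hi : i ∉ S) :
    annih i * creatProd stdVec S = (-1 : ℂ) ^ S.card • (creatProd stdVec S * annih i) := by
  induction S using Finset.induction_on_min with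
  | empty => simp [creatProd_empty]
  | insert a S h ih =>
    rw [Finset.mem_insert, not_or] at hi
    have e : annih i * creat a = -(creat a * annih i) :=
      eq_neg_of_add_eq_zero_left (annih_mul_creat_of_ne hi.1)
    rw [creatProd_insert_of_lt _ h, creatVec_stdVec, ← mul_assoc, e, neg_mul, mul_assoc, ih hi.2,
      Finset.card_insert_of_notMem (fun ha => (h a ha).false), pow_succ, mul_assoc]
    simp

theorem annihProd_mul_creat_comm {i : Fin n} {S : Finset (Fin n)} (hi : i ∉ S) :
    annihProd stdVec S * creat i = (-1 : ℂ) ^ S.card • (creat i * annihProd stdVec S) := by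
  have := congrArg conjTranspose (annih_mul_creatProd_comm hi)
  simpa [conjTranspose_annih, conjTranspose_creatProd] using this

theorem annihProd_mul_annih_comm (i : Fin n) (S : Finset (Fin n)) :
    annihProd stdVec S * annih i = (-1 : ℂ) ^ S.card • (annih i * annihProd stdVec S) := by
  have := congrArg conjTranspose (creatVec_mul_creatProd_comm (stdVec i) stdVec S)
  simpa [conjTranspose_creatVec, annihVec_stdVec, conjTranspose_creatProd] using this

theorem commute_mul_of_even {X Y Z : Op n} {k l : ℕ} (hkl : Even (k + l))
    (hX : Z * X = (-1 : ℂ) ^ k • (X * Z)) (hY : Y * Z = (-1 : ℂ) ^ l • (Z * Y)) :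
    Commute (X * Y) Z := by
  have hX' : X * Z = (-1 : ℂ) ^ k • (Z * X) := by
    rw [hX, smul_smul, ← mul_pow]; simp
  rw [commute_iff_eq, mul_assoc, hY, mul_smul_comm, ← mul_assoc, hX', smul_mul_assoc, smul_smul,
    ← pow_add, add_comm, hkl.neg_one_pow, one_smul, mul_assoc]

/-- Moving a_i or a†_i past a monomial away from i gives one sign per factor; evenness makes the
signs cancel. This is where even parity is essential. -/
theorem IsBKLocal.commute {S : Finset (Fin n)} {O : Op n} (hO : IsBKLocal S O) {i : Fin n}
    (hi : i ∉ S) : Commute O (annih i) ∧ Commute O (creat i) := by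
  refine Submodule.span_induction (p := fun O _ => Commute O (annih i) ∧ Commute O (creat i))
    ?_ ?_ ?_ ?_ hO
  · rintro _ ⟨S₁, S₂, h₁, h₂, he, rfl⟩
    constructor
    · exact commute_mul_of_even he (annih_mul_creatProd_comm fun h => hi (h₁ h))
        (annihProd_mul_annih_comm i S₂)
    · refine commute_mul_of_even he ?_ (annihProd_mul_creat_comm fun h => hi (h₂ h))
      rw [← creatVec_stdVec]
      exact creatVec_mul_creatProd_comm _ _ _
  · exact ⟨Commute.zero_left _, Commute.zero_left _⟩
  · exact fun _ _ _ _ h h' => ⟨h.1.add_left h'.1, h.2.add_left h'.2⟩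
  · exact fun c _ _ h => ⟨h.1.smul_left c, h.2.smul_left c⟩

theorem IsBKLocal.conjTranspose {S : Finset (Fin n)} {O : Op n} (hO : IsBKLocal S O) :
    IsBKLocal S Oᴴ := by
  refine Submodule.span_induction (p := fun O _ => IsBKLocal S Oᴴ) ?_ ?_ ?_ ?_ hO
  · rintro _ ⟨S₁, S₂, h₁, h₂, he, rfl⟩
    refine Submodule.subset_span ⟨S₂, S₁, h₂, h₁, by rwa [add_comm], ?_⟩
    rw [conjTranspose_mul, conjTranspose_creatProd, conjTranspose_annihProd]
  · simp [IsBKLocal]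
  · intro _ _ _ _ h h'
    rw [conjTranspose_add]; exact Submodule.add_mem _ h h'
  · intro c _ _ h
    rw [conjTranspose_smul]; exact Submodule.smul_mem _ _ h

theorem creat_mul_creatProd_of_mem {i : Fin n} {S : Finset (Fin n)} (hi : i ∈ S) :
    creat i * creatProd stdVec S = 0 := by
  rw [← creatVec_stdVec, creatVec_mul_creatProd, if_pos hi]

theorem annihProd_mul_annih_of_mem {i : Fin n} {S : Finset (Fin n)} (hi : i ∈ S) :
    annihProd stdVec S * annih i = 0 := by
  have := congrArg Matrix.conjTranspose (creat_mul_creatProd_of_mem hi)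
  rwa [conjTranspose_mul, conjTranspose_creat, conjTranspose_creatProd, conjTranspose_zero] at this

theorem creat_mul_annih_mul_creat (i : Fin n) : creat i * annih i * creat i = creat i := by
  have h := annih_mul_creat_self i
  have h' : creat i * creat i = 0 := by rw [← creatVec_stdVec, creatVec_mul_self]
  rw [mul_assoc, eq_sub_of_add_eq h, mul_sub, ← mul_assoc, h', mul_one, zero_mul, sub_zero]

theorem annih_mul_creat_mul_annih (i : Fin n) : annih i * creat i * annih i = annih i := by
  have := congrArg Matrix.conjTranspose (creat_mul_annih_mul_creat i)
  simpa [conjTranspose_creat, conjTranspose_annih, mul_assoc] using this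

/-- The conditional expectation onto the commutant of `a_i` and `a†_i`. -/
noncomputable def siteExpectation (i : Fin n) (O : Op n) : Op n :=
  annih i * creat i * O * (annih i * creat i) + creat i * O * annih i

theorem siteExpectation_of_commute {i : Fin n} {O : Op n} (h₁ : Commute O (annih i))
    (h₂ : Commute O (creat i)) : siteExpectation i O = O := by
  rw [siteExpectation, mul_assoc (annih i * creat i), (h₁.mul_right h₂).eq, mul_assoc (creat i),
    h₁.eq, ← mul_assoc, ← mul_assoc, ← mul_assoc, annih_mul_creat_mul_annih, ← add_mul,
    annih_mul_creat_self, one_mul]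

/-- With X the creation part and Y the annihilation part of a monomial, this kills every monomial
that involves the site i. -/
theorem siteExpectation_eq_zero {i : Fin n} {X Y : Op n} (h : creat i * X = 0 ∨ Y * annih i = 0) :
    siteExpectation i (X * Y) = 0 := by
  have e : siteExpectation i (X * Y) =
      annih i * (creat i * X) * (Y * annih i) * creat i + (creat i * X) * (Y * annih i) := by
    simp only [siteExpectation, mul_assoc]
  rcases h with h | h <;> simp [e, h]

/-- `siteExpectation i` fixes O, and on the spanning monomials it keeps those avoiding i and
annihilates the rest. No linear independence of monomials is needed. -/
theorem IsBKLocal.erase {A : Finset (Fin n)} {O : Op n} (hO : IsBKLocal A O) {i : Fin n}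
    (h₁ : Commute O (annih i)) (h₂ : Commute O (creat i)) : IsBKLocal (A.erase i) O := by
  rw [← siteExpectation_of_commute h₁ h₂]
  clear h₁ h₂
  refine Submodule.span_induction (p := fun O _ => IsBKLocal (A.erase i) (siteExpectation i O))
    ?_ ?_ ?_ ?_ hO
  · rintro _ ⟨S₁, S₂, h₁, h₂, he, rfl⟩
    by_cases hi : i ∈ S₁ ∨ i ∈ S₂
    · rw [siteExpectation_eq_zero]
      · exact Submodule.zero_mem _
      · exact hi.imp creat_mul_creatProd_of_mem annihProd_mul_annih_of_mem
    · rw [not_or] at hi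
      have hl : IsBKLocal (A.erase i) (creatProd stdVec S₁ * annihProd stdVec S₂) :=
        Submodule.subset_span ⟨S₁, S₂, Finset.subset_erase.2 ⟨h₁, hi.1⟩,
          Finset.subset_erase.2 ⟨h₂, hi.2⟩, he, rfl⟩
      have hc := hl.commute (Finset.notMem_erase i A)
      rwa [siteExpectation_of_commute hc.1 hc.2]
  · simp [siteExpectation, IsBKLocal]
  · intro X Y _ _ h h'
    have : siteExpectation i (X + Y) = siteExpectation i X + siteExpectation i Y := by
      simp only [siteExpectation, mul_add, add_mul]; abel
    rw [this]; exact Submodule.add_mem _ h h'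
  · intro c X _ h
    have : siteExpectation i (c • X) = c • siteExpectation i X := by
      simp [siteExpectation]
    rw [this]; exact Submodule.smul_mem _ _ h

/-! ### Change of modes in products of creation operators -/

/-- The span of the products of `a†(v j)`, `j ∈ A`, with a number of factors of the parity `p`. -/
noncomputable def creatSpan (v : Fin n → Fin n → ℂ) (A : Finset (Fin n)) (p : Prop) :
    Submodule ℂ (Op n) :=
  Submodule.span ℂ {X | ∃ T ⊆ A, (Even T.card ↔ p) ∧ X = creatProd v T}

theorem creatVec_add (v w : Fin n → ℂ) : creatVec (v + w) = creatVec v + creatVec w := by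
  simp [creatVec, add_smul, Finset.sum_add_distrib]

theorem creatVec_smul (c : ℂ) (v : Fin n → ℂ) : creatVec (c • v) = c • creatVec v := by
  simp [creatVec, Finset.smul_sum, smul_smul]

theorem creatVec_zero : creatVec (0 : Fin n → ℂ) = 0 := by simp [creatVec]

/-- Each factor flips the parity. Tracking it makes the change of modes preserve evenness. -/
theorem creatVec_mul_mem_creatSpan {v : Fin n → Fin n → ℂ} {A : Finset (Fin n)} {p : Prop}
    {u : Fin n → ℂ} (hu : u ∈ Submodule.span ℂ (v '' A)) {X : Op n} (hX : X ∈ creatSpan v A p) :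
    creatVec u * X ∈ creatSpan v A (¬ p) := by
  induction hu using Submodule.span_induction with
  | mem x hx =>
    obtain ⟨i, hi, rfl⟩ := hx
    induction hX using Submodule.span_induction with
    | mem X hX =>
      obtain ⟨T, hT, hp, rfl⟩ := hX
      rw [creatVec_mul_creatProd]
      split_ifs with h
      · exact Submodule.zero_mem _
      · refine Submodule.smul_mem _ _ (Submodule.subset_span ⟨insert i T, ?_, ?_, rfl⟩)
        · exact Finset.insert_subset hi hT
        · rw [Finset.card_insert_of_notMem h, Nat.even_add_one, hp]
    | zero => simp
    | add x y _ _ hx hy => rw [mul_add]; exact Submodule.add_mem _ hx hy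
    | smul c x _ hx => rw [mul_smul_comm]; exact Submodule.smul_mem _ _ hx
  | zero => simp [creatVec_zero]
  | add x y _ _ hx hy => rw [creatVec_add, add_mul]; exact Submodule.add_mem _ hx hy
  | smul c x _ hx => rw [creatVec_smul, smul_mul_assoc]; exact Submodule.smul_mem _ _ hx

theorem creatProd_mem_creatSpan {v w : Fin n → Fin n → ℂ} {A S : Finset (Fin n)}
    (hw : ∀ j ∈ A, w j ∈ Submodule.span ℂ (v '' A)) (hS : S ⊆ A) :
    creatProd w S ∈ creatSpan v A (Even S.card) := by
  induction S using Finset.induction_on_min with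
  | empty => exact Submodule.subset_span ⟨∅, by simp, Iff.rfl, by simp [creatProd_empty]⟩
  | insert a S h ih =>
    rw [Finset.insert_subset_iff] at hS
    rw [creatProd_insert_of_lt _ h, Finset.card_insert_of_notMem (fun ha => (h a ha).false),
      Nat.even_add_one]
    exact creatVec_mul_mem_creatSpan (hw a hS.1) (ih hS.2)

/-- Even combinations of `a†(e_i)`, `a(w_j)` with sites in `A`, for modes `w_j` in the span of other
modes `v_j`, are even combinations of `a†(e_i)`, `a(v_j)`. -/
theorem creatProd_mul_annihProd_mem_span {v w : Fin n → Fin n → ℂ} {A : Finset (Fin n)}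
    (hw : ∀ j ∈ A, w j ∈ Submodule.span ℂ (v '' A)) {S₁ S₂ : Finset (Fin n)} (h₁ : S₁ ⊆ A)
    (h₂ : S₂ ⊆ A) (he : Even (S₁.card + S₂.card)) :
    creatProd stdVec S₁ * annihProd w S₂ ∈ Submodule.span ℂ
      {X : Op n | ∃ T₁ T₂ : Finset (Fin n), T₁ ⊆ A ∧ T₂ ⊆ A ∧ Even (T₁.card + T₂.card) ∧
        X = creatProd stdVec T₁ * annihProd v T₂} := by
  rw [← conjTranspose_creatProd w]
  have hX := creatProd_mem_creatSpan hw h₂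
  generalize creatProd w S₂ = X at hX
  induction hX using Submodule.span_induction with
  | mem X hX =>
    obtain ⟨T, hT, hp, rfl⟩ := hX
    rw [conjTranspose_creatProd]
    refine Submodule.subset_span ⟨S₁, T, h₁, hT, ?_, rfl⟩
    rw [Nat.even_add] at he ⊢
    rw [hp, he]
  | zero => simp
  | add x y _ _ hx hy => rw [conjTranspose_add, mul_add]; exact Submodule.add_mem _ hx hy
  | smul c x _ hx =>
    rw [conjTranspose_smul, mul_smul_comm]; exact Submodule.smul_mem _ _ hx

/-! ### Observables of a total metric -/

namespace IsTotalMetric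

variable {M : Matrix (Fin n) (Fin n) ℂ} {η : Op n}

theorem mul_creatProd (h : IsTotalMetric M η) (v : Fin n → Fin n → ℂ) (S : Finset (Fin n)) :
    η * creatProd v S = creatProd (fun j => M *ᵥ v j) S * η := by
  induction S using Finset.induction_on_min with
  | empty => simp [creatProd_empty]
  | insert a S hS ih =>
    rw [creatProd_insert_of_lt _ hS, creatProd_insert_of_lt _ hS, ← mul_assoc, h.mul_creatVec,
      mul_assoc, ih, mul_assoc]

theorem mul_annihProd (h : IsTotalMetric M η) (hM : M.IsHermitian) (v : Fin n → Fin n → ℂ)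
    (S : Finset (Fin n)) :
    η * annihProd (fun j => M *ᵥ v j) S = annihProd v S * η := by
  have := congrArg Matrix.conjTranspose (h.mul_creatProd v S)
  rw [conjTranspose_mul, conjTranspose_mul, (h.isHermitian hM).eq, conjTranspose_creatProd,
    conjTranspose_creatProd] at this
  exact this.symm

/-- The source of the condition O_{S₁S₂} = conj O_{S₂S₁}: passing η through turns e_i into M e_i in
the creation part and M e_j into e_j in the annihilation part. -/
theorem mul_creatProd_mul_annihProd (h : IsTotalMetric M η) (hM : M.IsHermitian)
    (S₁ S₂ : Finset (Fin n)) :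
    η * (creatProd stdVec S₁ * annihProd (fun j => M *ᵥ stdVec j) S₂) =
      (creatProd stdVec S₂ * annihProd (fun j => M *ᵥ stdVec j) S₁)ᴴ * η := by
  rw [← mul_assoc, h.mul_creatProd, mul_assoc, h.mul_annihProd hM, conjTranspose_mul,
    conjTranspose_annihProd, conjTranspose_creatProd, mul_assoc]

end IsTotalMetric

theorem generalLocal_eq {M : Matrix (Fin n) (Fin n) ℂ} {A : Finset (Fin n)}
    (hA : ∀ j ∈ A, diagBlock M A *ᵥ stdVec j = M *ᵥ stdVec j)
    (c : Finset (Fin n) → Finset (Fin n) → ℂ) :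
    generalLocal M A c = ∑ S₁ ∈ A.powerset, ∑ S₂ ∈ A.powerset,
      c S₁ S₂ • (creatProd stdVec S₁ * annihProd (fun j => M *ᵥ stdVec j) S₂) := by
  refine Finset.sum_congr rfl fun S₁ _ => Finset.sum_congr rfl fun S₂ h₂ => ?_
  rw [annihProd_congr fun j hj => hA j (Finset.mem_powerset.1 h₂ hj)]

theorem IsTotalMetric.mul_generalLocal {M : Matrix (Fin n) (Fin n) ℂ} {η : Op n}
    (h : IsTotalMetric M η) (hM : M.IsHermitian) {A : Finset (Fin n)}
    (hA : ∀ j ∈ A, diagBlock M A *ᵥ stdVec j = M *ᵥ stdVec j)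
    (c : Finset (Fin n) → Finset (Fin n) → ℂ) :
    η * generalLocal M A c = (generalLocal M A fun S₁ S₂ => star (c S₂ S₁))ᴴ * η := by
  rw [generalLocal_eq hA, generalLocal_eq hA, Finset.sum_comm]
  simp only [Finset.mul_sum, Finset.sum_mul, conjTranspose_sum, conjTranspose_smul, star_star,
    mul_smul_comm, smul_mul_assoc, h.mul_creatProd_mul_annihProd hM]

theorem generalLocal_add (M : Matrix (Fin n) (Fin n) ℂ) (A : Finset (Fin n))
    (c d : Finset (Fin n) → Finset (Fin n) → ℂ) :
    generalLocal M A (c + d) = generalLocal M A c + generalLocal M A d := by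
  simp [generalLocal, add_smul, Finset.sum_add_distrib]

theorem generalLocal_smul (M : Matrix (Fin n) (Fin n) ℂ) (A : Finset (Fin n)) (x : ℂ)
    (c : Finset (Fin n) → Finset (Fin n) → ℂ) :
    generalLocal M A (x • c) = x • generalLocal M A c := by
  simp [generalLocal, Finset.smul_sum, smul_smul]

theorem isBKLocal_generalLocal (M : Matrix (Fin n) (Fin n) ℂ) {A : Finset (Fin n)}
    {c : Finset (Fin n) → Finset (Fin n) → ℂ}
    (hc : ∀ S₁ S₂, Odd (S₁.card + S₂.card) → c S₁ S₂ = 0) :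
    IsBKLocal A (generalLocal M A c) := by
  refine Submodule.sum_mem _ fun S₁ h₁ => Submodule.sum_mem _ fun S₂ h₂ => ?_
  rw [Finset.mem_powerset] at h₁ h₂
  rcases Nat.even_or_odd (S₁.card + S₂.card) with he | ho
  · refine Submodule.smul_mem _ _ (creatProd_mul_annihProd_mem_span (fun j _ => ?_) h₁ h₂ he)
    rw [← sum_smul_stdVec (diagBlock M A *ᵥ stdVec j)]
    refine Submodule.sum_mem _ fun k _ => ?_
    by_cases hk : k ∈ A
    · exact Submodule.smul_mem _ _ (Submodule.subset_span ⟨k, hk, rfl⟩)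
    · have : (diagBlock M A *ᵥ stdVec j) k = 0 := by simp [stdVec, diagBlock, hk]
      rw [this, zero_smul]
      exact Submodule.zero_mem _
  · rw [hc _ _ ho, zero_smul]
    exact Submodule.zero_mem _

/-- The hypothesis says that the block M^{AA} is onto the span of the sites of `A`, so each a(e_j)
can be rewritten in the modes a(M^{AA} e_k). -/
theorem IsBKLocal.exists_generalLocal {M : Matrix (Fin n) (Fin n) ℂ} {A : Finset (Fin n)}
    (hA : ∀ j ∈ A, stdVec j ∈ Submodule.span ℂ ((fun k => diagBlock M A *ᵥ stdVec k) '' A))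
    {O : Op n} (hO : IsBKLocal A O) :
    ∃ c : Finset (Fin n) → Finset (Fin n) → ℂ,
      (∀ S₁ S₂, Odd (S₁.card + S₂.card) → c S₁ S₂ = 0) ∧ O = generalLocal M A c := by
  have hO' : O ∈ Submodule.span ℂ
      {X : Op n | ∃ T₁ T₂ : Finset (Fin n), T₁ ⊆ A ∧ T₂ ⊆ A ∧ Even (T₁.card + T₂.card) ∧
        X = creatProd stdVec T₁ * annihProd (fun k => diagBlock M A *ᵥ stdVec k) T₂} := by
    refine Submodule.span_le.2 ?_ hO
    rintro _ ⟨S₁, S₂, h₁, h₂, he, rfl⟩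
    exact creatProd_mul_annihProd_mem_span hA h₁ h₂ he
  clear hO
  induction hO' using Submodule.span_induction with
  | mem X hX =>
    obtain ⟨T₁, T₂, h₁, h₂, he, rfl⟩ := hX
    refine ⟨Pi.single T₁ (Pi.single T₂ 1), fun S₁ S₂ ho => ?_, ?_⟩
    · by_cases h : S₁ = T₁
      · subst h
        rw [Pi.single_eq_same, Pi.single_eq_of_ne]
        rintro rfl
        exact (Nat.not_even_iff_odd.2 ho) he
      · rw [Pi.single_eq_of_ne h]; rfl
    · rw [generalLocal, Finset.sum_eq_single T₁, Finset.sum_eq_single T₂]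
      · simp
      · intro S _ h; simp [h]
      · intro h; exact absurd (Finset.mem_powerset.2 h₂) h
      · intro S _ h; simp [h]
      · intro h; exact absurd (Finset.mem_powerset.2 h₁) h
  | zero => exact ⟨0, by simp, by simp [generalLocal]⟩
  | add x y _ _ hx hy =>
    obtain ⟨c, hc, rfl⟩ := hx
    obtain ⟨d, hd, rfl⟩ := hy
    exact ⟨c + d, fun S₁ S₂ h => by simp [hc _ _ h, hd _ _ h], (generalLocal_add M A c d).symm⟩
  | smul a x _ hx =>
    obtain ⟨c, hc, rfl⟩ := hx
    exact ⟨a • c, fun S₁ S₂ h => by simp [hc _ _ h], (generalLocal_smul M A a c).symm⟩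

theorem isBKLocal_and_isObservable_iff {M : Matrix (Fin n) (Fin n) ℂ} {η : Op n}
    (h : IsTotalMetric M η) (hM : M.PosDef) {A : Finset (Fin n)}
    (hA : ∀ j ∈ A, diagBlock M A *ᵥ stdVec j = M *ᵥ stdVec j)
    (hA' : ∀ j ∈ A, stdVec j ∈ Submodule.span ℂ ((fun k => diagBlock M A *ᵥ stdVec k) '' A))
    (O : Op n) :
    (IsBKLocal A O ∧ IsObservable η O) ↔
      ∃ c : Finset (Fin n) → Finset (Fin n) → ℂ,
        (∀ S₁ S₂, c S₁ S₂ = star (c S₂ S₁)) ∧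
        (∀ S₁ S₂, Odd (S₁.card + S₂.card) → c S₁ S₂ = 0) ∧ O = generalLocal M A c := by
  have hH := hM.isHermitian
  constructor
  · rintro ⟨hl, ho⟩
    obtain ⟨c, hc, rfl⟩ := hl.exists_generalLocal hA'
    set d : Finset (Fin n) → Finset (Fin n) → ℂ := fun S₁ S₂ => star (c S₂ S₁) with hd
    have e : generalLocal M A c = generalLocal M A d := by
      rw [IsObservable, h.mul_generalLocal hH hA] at ho
      exact (conjTranspose_injective ((h.isUnit hM.isUnit).mul_right_cancel ho)).symm
    -- Averaging `c` with its Hermitian conjugate `d`, which represents the same operator, gives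
    -- symmetric coefficients without proving that coefficients are unique.
    refine ⟨(1 / 2 : ℂ) • (c + d), fun S₁ S₂ => ?_, fun S₁ S₂ hS => ?_, ?_⟩
    · simp [hd, add_comm]
    · simp [hd, hc _ _ hS, hc S₂ S₁ (by rwa [add_comm])]
    · rw [generalLocal_smul, generalLocal_add, ← e, ← two_smul ℂ, smul_smul]
      simp
  · rintro ⟨c, hc, ho, rfl⟩
    refine ⟨isBKLocal_generalLocal M ho, ?_⟩
    rw [IsObservable, h.mul_generalLocal hH hA]
    simp only [← hc]

end

/-! ### Which subsystems carry extensively local observables -/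

section

variable {n : ℕ}

theorem creat_mul_annih_isBKLocal {A : Finset (Fin n)} {i k : Fin n} (hi : i ∈ A) (hk : k ∈ A) :
    IsBKLocal A (creat i * annih k) := by
  refine Submodule.subset_span ⟨{i}, {k}, by simpa, by simpa, by simp, ?_⟩
  simp [creatProd, annihProd, creatVec_stdVec, annihVec_stdVec]

theorem annih_mul_annihVec (l : Fin n) (w : Fin n → ℂ) :
    annih l * annihVec w = -(annihVec w * annih l) := by
  have := congrArg conjTranspose (creatVec_mul_comm w (stdVec l))
  simpa [conjTranspose_creatVec, annihVec_stdVec] using this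

theorem IsTotalMetric.mul_annihVec {M : Matrix (Fin n) (Fin n) ℂ} {η : Op n}
    (h : IsTotalMetric M η) (hM : M.IsHermitian) (i : Fin n) :
    η * annihVec (M *ᵥ stdVec i) = annih i * η := by
  rw [h.annih_mul, hM.eq]

theorem mulVec_stdVec_apply (M : Matrix (Fin n) (Fin n) ℂ) (i j : Fin n) :
    (M *ᵥ stdVec j) i = M i j := by simp [stdVec]

/-- If `M` does not couple `A` to its complement, the number operator of `A` with respect to the
metric is an extensively local observable. -/
theorem IsTotalMetric.hasExtensivelyLocalObservable {M : Matrix (Fin n) (Fin n) ℂ} {η : Op n}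
    (h : IsTotalMetric M η) (hM : M.PosDef) {A : Finset (Fin n)}
    (hA : ∀ i ∈ A, ∀ k, k ∉ A → M k i = 0) : HasExtensivelyLocalObservable η A := by
  have hH := hM.isHermitian
  refine ⟨∑ i ∈ A, creat i * annihVec (M *ᵥ stdVec i), ?_, ?_, ?_⟩
  · rw [IsObservable, Finset.mul_sum, conjTranspose_sum, Finset.sum_mul]
    refine Finset.sum_congr rfl fun i _ => ?_
    rw [← mul_assoc, ← creatVec_stdVec, h.mul_creatVec, mul_assoc, h.mul_annihVec hH,
      conjTranspose_mul, conjTranspose_annihVec, conjTranspose_creatVec, annihVec_stdVec, mul_assoc]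
  · refine Submodule.sum_mem _ fun i hi => ?_
    rw [annihVec, Finset.mul_sum]
    refine Submodule.sum_mem _ fun k _ => ?_
    rw [mul_smul_comm]
    by_cases hk : k ∈ A
    · exact Submodule.smul_mem _ _ (creat_mul_annih_isBKLocal hi hk)
    · rw [mulVec_stdVec_apply, hA i hi k hk, star_zero, zero_smul]
      exact Submodule.zero_mem _
  · intro S hS hl
    obtain ⟨l, hlA, hlS⟩ := Finset.exists_of_ssubset hS
    -- The commutator of a_l with the number operator is a(M e_l). Locality away from l would force
    -- it to vanish, although its anticommutator with a†_l is the scalar conj M_{ll}, nonzero by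
    -- positivity.
    have hc : annih l * ∑ i ∈ A, creat i * annihVec (M *ᵥ stdVec i) =
        (∑ i ∈ A, creat i * annihVec (M *ᵥ stdVec i)) * annih l + annihVec (M *ᵥ stdVec l) := by
      have : annihVec (M *ᵥ stdVec l) =
          ∑ i ∈ A, if l = i then annihVec (M *ᵥ stdVec i) else 0 := by
        simp [hlA]
      rw [this, Finset.mul_sum, Finset.sum_mul, ← Finset.sum_add_distrib]
      refine Finset.sum_congr rfl fun i _ => ?_
      rw [← mul_assoc, eq_sub_of_add_eq (annih_mul_creat l i), sub_mul, mul_assoc (creat i),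
        annih_mul_annihVec, mul_assoc]
      split_ifs <;> simp [add_comm]
    rw [← ((hl.commute hlS).1).eq, left_eq_add] at hc
    have e := annihVec_mul_creat (M *ᵥ stdVec l) l
    rw [hc, zero_mul, mul_zero, add_zero, mulVec_stdVec_apply] at e
    have e' := congrFun (congrFun e ∅) ∅
    simp at e'
    exact hM.diag_pos.ne' ((map_eq_zero _).1 e'.symm)

/-- A column of the adjugate of a 2×2 block: a vector mixing e_i and e_j that `M` sends to a
multiple of e_j alone. -/
theorem mulVec_stdVec_of_block {M : Matrix (Fin n) (Fin n) ℂ} {i j : Fin n} (hij : i ≠ j)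
    (hk : ∀ k, k ≠ i → k ≠ j → M k i = 0 ∧ M k j = 0) :
    M *ᵥ (M i i • stdVec j - M i j • stdVec i) =
      (M i i * M j j - M i j * M j i) • stdVec j := by
  ext k
  simp only [mulVec_sub, mulVec_smul, Pi.sub_apply, Pi.smul_apply,
    smul_eq_mul, stdVec, Pi.single_apply]
  by_cases h1 : k = i
  · subst h1; simp [hij]; ring
  · by_cases h2 : k = j
    · subst h2; simp
    · simp [hk k h1 h2, h2]

/-- A local observable of a block with exactly one of its two sites in `A` is local to the rest
of `A`. -/
theorem IsBKLocal.erase_of_isObservable {M : Matrix (Fin n) (Fin n) ℂ} {η : Op n}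
    (h : IsTotalMetric M η) (hM : M.PosDef) {A : Finset (Fin n)} {O : Op n} (hO : IsBKLocal A O)
    (hobs : IsObservable η O) {i j : Fin n} (hj : j ∉ A) (hij : i ≠ j) (hMij : M i j ≠ 0)
    (hk : ∀ k, k ≠ i → k ≠ j → M k i = 0 ∧ M k j = 0) : IsBKLocal (A.erase i) O := by
  have hη := h.isUnit hM.isUnit
  obtain ⟨c1, c2⟩ := hO.commute hj
  obtain ⟨d1, d2⟩ := hO.conjTranspose.commute hj
  rw [IsObservable] at hobs
  -- Since η O η⁻¹ = O† and η X η⁻¹ = Y, commutation of O† with Y pulls back to commutation of O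
  -- with X.
  have transfer : ∀ {X Y : Op n}, η * X = Y * η → Commute Oᴴ Y → Commute O X := by
    intro X Y hXY hY
    refine hη.mul_left_cancel ?_
    rw [← mul_assoc, hobs, mul_assoc, hXY, ← mul_assoc, hY.eq, mul_assoc, ← hobs, ← mul_assoc,
      ← hXY, mul_assoc]
  refine hO.erase ?_ ?_
  · have e : annihVec (M *ᵥ stdVec j) = star (M j j) • annih j + star (M i j) • annih i := by
      rw [annihVec, ← Finset.sum_subset (Finset.subset_univ {j, i})]
      · rw [Finset.sum_pair hij.symm, mulVec_stdVec_apply, mulVec_stdVec_apply]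
      · intro k _ hk'
        simp only [Finset.mem_insert, Finset.mem_singleton, not_or] at hk'
        rw [mulVec_stdVec_apply, (hk k hk'.2 hk'.1).2, star_zero, zero_smul]
    have hc := transfer (h.mul_annihVec hM.isHermitian j) d1
    rw [e] at hc
    have hc' := hc.sub_right (c1.smul_right (star (M j j)))
    rw [add_sub_cancel_left] at hc'
    simpa [smul_smul, hMij] using hc'.smul_right (star (M i j))⁻¹
  · have e : creatVec (M i i • stdVec j - M i j • stdVec i) =
        M i i • creat j - M i j • creat i := by
      rw [sub_eq_add_neg, ← neg_smul, creatVec_add, creatVec_smul, creatVec_smul, creatVec_stdVec,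
        creatVec_stdVec, neg_smul, ← sub_eq_add_neg]
    have hc := h.mul_creatVec (M i i • stdVec j - M i j • stdVec i)
    rw [mulVec_stdVec_of_block hij hk, creatVec_smul, creatVec_stdVec] at hc
    have hc := transfer hc (d2.smul_right _)
    rw [e] at hc
    have hc' := (c2.smul_right (M i i)).sub_right hc
    rw [sub_sub_cancel] at hc'
    simpa [smul_smul, hMij] using hc'.smul_right (M i j)⁻¹

theorem image_eq_self_iff {f : Fin n → Fin n} (hf : Function.Involutive f) {A : Finset (Fin n)} :
    A.image f = A ↔ ∀ i ∈ A, f i ∈ A := by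
  constructor
  · intro h i hi
    rw [← h]; exact Finset.mem_image_of_mem f hi
  · intro h
    ext i
    rw [Finset.mem_image]
    exact ⟨by rintro ⟨j, hj, rfl⟩; exact h j hj, fun hi => ⟨f i, h i hi, hf i⟩⟩

section Involution

variable {M : Matrix (Fin n) (Fin n) ℂ} {η : Op n} {f : Fin n → Fin n}

theorem hasExtensivelyLocalObservable_iff (h : IsTotalMetric M η) (hM : M.PosDef)
    (hf : Function.Involutive f) (hMf : ∀ i j, M i j ≠ 0 ↔ (i = f j ∨ i = j))
    (A : Finset (Fin n)) : HasExtensivelyLocalObservable η A ↔ A.image f = A := by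
  rw [image_eq_self_iff hf]
  constructor
  · rintro ⟨O, hobs, hO, hmin⟩ i hi
    by_contra hj
    have hij : i ≠ f i := fun e => hj (e ▸ hi)
    refine hmin _ (Finset.erase_ssubset hi)
      (hO.erase_of_isObservable h hM hobs hj hij ((hMf _ _).2 (Or.inl (hf i).symm)) ?_)
    intro k h1 h2
    constructor <;> by_contra hne
    · rcases (hMf _ _).1 hne with e | e
      · exact h2 e
      · exact h1 e
    · rcases (hMf _ _).1 hne with e | e
      · exact h1 (e.trans (hf i))
      · exact h2 e
  · intro hA
    refine h.hasExtensivelyLocalObservable hM fun i hi k hk => ?_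
    by_contra hne
    rcases (hMf _ _).1 hne with rfl | rfl
    · exact hk (hA i hi)
    · exact hk hi

theorem diagBlock_mulVec_stdVec (hMf : ∀ i j, M i j ≠ 0 ↔ (i = f j ∨ i = j))
    {A : Finset (Fin n)} (hA : ∀ i ∈ A, f i ∈ A) {j : Fin n} (hj : j ∈ A) :
    diagBlock M A *ᵥ stdVec j = M *ᵥ stdVec j := by
  ext i
  rw [mulVec_stdVec_apply, mulVec_stdVec_apply, diagBlock, of_apply]
  by_cases hi : i ∈ A
  · simp [hi, hj]
  · rw [if_neg (fun h => hi h.1)]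
    by_contra hne
    rcases (hMf _ _).1 (Ne.symm hne) with rfl | rfl
    · exact hi (hA j hj)
    · exact hi hj

/-- The block containing j lies inside `A` and is invertible, so e_j is recovered from its columns.
-/
theorem stdVec_mem_span_mulVec (hM : M.PosDef) (hf : Function.Involutive f)
    (hMf : ∀ i j, M i j ≠ 0 ↔ (i = f j ∨ i = j)) {A : Finset (Fin n)} (hA : ∀ i ∈ A, f i ∈ A)
    {j : Fin n} (hj : j ∈ A) :
    stdVec j ∈ Submodule.span ℂ ((fun k => M *ᵥ stdVec k) '' A) := by
  have hmem : ∀ k ∈ A, M *ᵥ stdVec k ∈ Submodule.span ℂ ((fun k => M *ᵥ stdVec k) '' A) :=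
    fun k hk => Submodule.subset_span ⟨k, hk, rfl⟩
  have hd : ∀ {d : ℂ}, d ≠ 0 → d • stdVec j ∈ Submodule.span ℂ ((fun k => M *ᵥ stdVec k) '' A) →
      stdVec j ∈ Submodule.span ℂ ((fun k => M *ᵥ stdVec k) '' A) :=
    fun hd h => (Submodule.smul_mem_iff _ hd).1 h
  by_cases hfj : f j = j
  · refine hd (d := M j j) hM.diag_pos.ne' ?_
    have : M j j • stdVec j = M *ᵥ stdVec j := by
      ext i
      rw [mulVec_stdVec_apply]
      by_cases hi : i = j
      · subst hi; simp [stdVec]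
      · have : M i j = 0 := by
          by_contra hne
          rcases (hMf _ _).1 hne with e | e
          · exact hi (e.trans hfj)
          · exact hi e
        simp [stdVec, hi, this]
    rw [this]
    exact hmem j hj
  · have hk : ∀ k, k ≠ f j → k ≠ j → M k (f j) = 0 ∧ M k j = 0 := by
      intro k h1 h2
      constructor <;> by_contra hne
      · rcases (hMf _ _).1 hne with e | e
        · exact h2 (e.trans (hf j))
        · exact h1 e
      · rcases (hMf _ _).1 hne with e | e
        · exact h1 e
        · exact h2 e
    have e := mulVec_stdVec_of_block hfj hk
    refine hd (d := M (f j) (f j) * M j j - M (f j) j * M j (f j)) ?_ ?_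
    · intro h0
      rw [h0, zero_smul, ← mulVec_zero M] at e
      have := congrFun (mulVec_injective_of_isUnit hM.isUnit e) (f j)
      simp [stdVec, hfj] at this
      exact (hMf _ _).2 (Or.inl rfl) this
    · rw [← e, mulVec_sub, mulVec_smul, mulVec_smul]
      exact Submodule.sub_mem _ (Submodule.smul_mem _ _ (hmem j hj))
        (Submodule.smul_mem _ _ (hmem _ (hA j hj)))

theorem isBKLocal_and_isObservable_iff_of_involutive (h : IsTotalMetric M η) (hM : M.PosDef)
    (hf : Function.Involutive f) (hMf : ∀ i j, M i j ≠ 0 ↔ (i = f j ∨ i = j))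
    {A : Finset (Fin n)} (hA : A.image f = A) (O : Op n) :
    (IsBKLocal A O ∧ IsObservable η O) ↔
      ∃ c : Finset (Fin n) → Finset (Fin n) → ℂ,
        (∀ S₁ S₂, c S₁ S₂ = star (c S₂ S₁)) ∧
        (∀ S₁ S₂, Odd (S₁.card + S₂.card) → c S₁ S₂ = 0) ∧ O = generalLocal M A c := by
  rw [image_eq_self_iff hf] at hA
  have hB := fun j (hj : j ∈ A) => diagBlock_mulVec_stdVec hMf hA hj
  refine isBKLocal_and_isObservable_iff h hM hB (fun j hj => ?_) O
  rw [Set.image_congr (g := fun k => M *ᵥ stdVec k) fun k hk => hB k hk]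
  exact stdVec_mem_span_mulVec hM hf hMf hA hj

end Involution

/-- A quadratic Hamiltonian is an observable as soon as its first quantization is quasi-Hermitian
for the reduced metric. -/
theorem IsTotalMetric.isObservable_quadratic {M G : Matrix (Fin n) (Fin n) ℂ} {η : Op n}
    (h : IsTotalMetric M η) (hM : M.IsHermitian) (hG : M * G = Gᴴ * M) :
    IsObservable η (∑ i, ∑ j, G i j • (creat i * annih j)) := by
  have hl : η * (∑ i, ∑ j, G i j • (creat i * annih j)) =
      ∑ k, ∑ j, (M * G) k j • (creat k * (η * annih j)) := by
    have : ∀ i j, η * (creat i * annih j) = ∑ k, M k i • (creat k * (η * annih j)) := by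
      intro i j
      rw [← mul_assoc, h.1, Finset.sum_mul]
      simp [mul_assoc]
    simp only [Finset.mul_sum, mul_smul_comm, this, Matrix.mul_apply, Finset.sum_smul,
      Finset.smul_sum, smul_smul]
    calc _ = ∑ i, ∑ k, ∑ j, (G i j * M k i) • (creat k * (η * annih j)) :=
          Finset.sum_congr rfl fun i _ => Finset.sum_comm
      _ = ∑ k, ∑ i, ∑ j, (G i j * M k i) • (creat k * (η * annih j)) := Finset.sum_comm
      _ = ∑ k, ∑ j, ∑ i, (G i j * M k i) • (creat k * (η * annih j)) :=
          Finset.sum_congr rfl fun i _ => Finset.sum_comm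
      _ = _ := by simp only [mul_comm]
  have hr : (∑ i, ∑ j, G i j • (creat i * annih j))ᴴ * η =
      ∑ k, ∑ j, (Gᴴ * M) k j • (creat k * (η * annih j)) := by
    have : ∀ i, annih i * η = ∑ k, M i k • (η * annih k) := by
      intro i
      rw [← h.mul_annihVec hM, annihVec, Finset.mul_sum]
      refine Finset.sum_congr rfl fun k _ => ?_
      rw [mulVec_stdVec_apply, hM.apply, mul_smul_comm]
    simp only [conjTranspose_sum, conjTranspose_smul, conjTranspose_mul, conjTranspose_creat,
      conjTranspose_annih, Finset.sum_mul, smul_mul_assoc, mul_assoc, this, Matrix.mul_apply,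
      Finset.sum_smul, Finset.mul_sum, Finset.smul_sum, mul_smul_comm, smul_smul,
      conjTranspose_apply]
    calc _ = ∑ j, ∑ i, ∑ k, (star (G i j) * M i k) • (creat j * (η * annih k)) := Finset.sum_comm
      _ = _ := Finset.sum_congr rfl fun i _ => Finset.sum_comm
  rw [IsObservable, hl, hr, hG]

end

section

variable {m : ℕ}

/-! ### Parity blocks -/

/-- Diagonal and off-diagonal recurrences have ratios of equal modulus, so the relative size ‖c‖ of
the off-diagonal entry is constant along the chain. -/
theorem fromCentre_real {r s : ℕ → ℂ} {c : ℂ}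
    (hr : ∀ k, 1 ≤ k → k < m → r k = (‖s k‖ : ℂ) ∧ s k ≠ 0) {d : ℕ} (hd : d < m) :
    ∃ x : ℝ, 0 < x ∧ fromCentre m r 1 d = x ∧ ‖fromCentre m s c d‖ = ‖c‖ * x := by
  induction d with
  | zero => exact ⟨1, one_pos, by simp [fromCentre], by simp [fromCentre]⟩
  | succ d ih =>
    obtain ⟨x, hx, h1, h2⟩ := ih (by omega)
    obtain ⟨e, hne⟩ := hr (m - (d + 1)) (by omega) (by omega)
    refine ⟨‖s (m - (d + 1))‖ * x, mul_pos (norm_pos_iff.2 hne) hx, ?_, ?_⟩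
    · rw [fromCentre, h1, e]; push_cast; rfl
    · rw [fromCentre, norm_mul, h2]; ring

/-- The distance of a site from the centre of the chain. -/
def centreDist (m : ℕ) (i : Fin (2 * m)) : ℕ :=
  if (i : ℕ) < m then m - ((i : ℕ) + 1) else (i : ℕ) - m

theorem centreDist_lt (i : Fin (2 * m)) : centreDist m i < m := by
  unfold centreDist; have := i.2; split_ifs <;> omega

theorem rev_ne (i : Fin (2 * m)) : i.rev ≠ i := by
  intro h
  have := congrArg Fin.val h
  rw [Fin.val_rev] at this
  omega

theorem parityBlocks_self (r s : ℕ → ℂ) (c : ℂ) (i : Fin (2 * m)) :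
    parityBlocks m r s c i i = fromCentre m r 1 (centreDist m i) := by
  simp only [parityBlocks, of_apply, if_true, centreDist]
  split_ifs <;> rfl

theorem parityBlocks_rev (r s : ℕ → ℂ) (c : ℂ) (i : Fin (2 * m)) :
    parityBlocks m r s c i i.rev = if (i : ℕ) < m then fromCentre m s c (centreDist m i)
      else star (fromCentre m s c (centreDist m i)) := by
  simp only [parityBlocks, of_apply, (rev_ne i).symm, if_false, Fin.rev_rev, if_true, centreDist]
  split_ifs <;> rfl

theorem parityBlocks_of_ne (r s : ℕ → ℂ) (c : ℂ) {i j : Fin (2 * m)} (h1 : i ≠ j)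
    (h2 : i ≠ j.rev) : parityBlocks m r s c i j = 0 := by
  simp [parityBlocks, h1, h2]

theorem centreDist_rev (i : Fin (2 * m)) : centreDist m i.rev = centreDist m i := by
  have := i.2
  simp only [centreDist, Fin.val_rev]
  split_ifs <;> omega

theorem star_parityBlocks_rev (r s : ℕ → ℂ) (c : ℂ) (i : Fin (2 * m)) :
    star (parityBlocks m r s c i.rev i) = parityBlocks m r s c i i.rev := by
  have h := parityBlocks_rev r s c i.rev
  rw [Fin.rev_rev, centreDist_rev, Fin.val_rev] at h
  rw [h, parityBlocks_rev]
  have := i.2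
  split_ifs <;> first | omega | simp

theorem norm_parityBlocks_rev (r s : ℕ → ℂ) (c : ℂ) (i : Fin (2 * m)) :
    ‖parityBlocks m r s c i i.rev‖ = ‖fromCentre m s c (centreDist m i)‖ := by
  rw [parityBlocks_rev]
  split_ifs <;> simp

theorem parityBlocks_isHermitian {r s : ℕ → ℂ} {c : ℂ}
    (hr : ∀ k, 1 ≤ k → k < m → r k = (‖s k‖ : ℂ) ∧ s k ≠ 0) :
    (parityBlocks m r s c).IsHermitian := by
  refine IsHermitian.ext fun i j => ?_
  by_cases h1 : i = j
  · subst h1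
    obtain ⟨x, -, hx, -⟩ := fromCentre_real (c := c) hr (centreDist_lt i)
    rw [parityBlocks_self, hx]
    simp
  · by_cases h2 : j = i.rev
    · subst h2
      exact star_parityBlocks_rev r s c i
    · rw [parityBlocks_of_ne r s c (Ne.symm h1) h2, parityBlocks_of_ne r s c h1, star_zero]
      rintro rfl; simp at h2

theorem parityBlocks_posDef {r s : ℕ → ℂ} {c : ℂ}
    (hr : ∀ k, 1 ≤ k → k < m → r k = (‖s k‖ : ℂ) ∧ s k ≠ 0) (hc : ‖c‖ < 1) :
    (parityBlocks m r s c).PosDef := by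
  have hH := parityBlocks_isHermitian (c := c) hr
  rw [hH.posDef_iff_eigenvalues_pos]
  intro a
  have hev : Module.End.HasEigenvalue (Matrix.toLin' (parityBlocks m r s c))
      ((hH.eigenvalues a : ℝ) : ℂ) := by
    refine Module.End.hasEigenvalue_of_hasEigenvector
      (x := (hH.eigenvectorBasis a).ofLp) ⟨?_, ?_⟩
    · rw [Module.End.mem_eigenspace_iff, Matrix.toLin'_apply, hH.mulVec_eigenvectorBasis]
      rfl
    · intro h0
      exact (hH.eigenvectorBasis.orthonormal.ne_zero a) (by ext x; exact congrFun h0 x)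
  -- Gershgorin: row k has diagonal entry x > 0 and a single off-diagonal position, of modulus ‖c‖ x
  -- < x.
  obtain ⟨k, hk⟩ := eigenvalue_mem_ball hev
  obtain ⟨x, hx0, hx, hx'⟩ := fromCentre_real (c := c) hr (centreDist_lt k)
  rw [Finset.sum_eq_single k.rev, norm_parityBlocks_rev, hx', parityBlocks_self, hx,
    Metric.mem_closedBall, Complex.dist_eq, ← Complex.ofReal_sub, Complex.norm_real,
    Real.norm_eq_abs] at hk
  · nlinarith [neg_abs_le (hH.eigenvalues a - x)]
  · intro j hj hj'
    rw [parityBlocks_of_ne r s c (Finset.ne_of_mem_erase hj).symm, norm_zero]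
    rintro rfl; simp at hj'
  · intro h
    exact absurd (Finset.mem_erase.2 ⟨rev_ne k, Finset.mem_univ _⟩) h

theorem parityBlocks_ne_zero_iff {r s : ℕ → ℂ} {c : ℂ}
    (hr : ∀ k, 1 ≤ k → k < m → r k = (‖s k‖ : ℂ) ∧ s k ≠ 0) (hc : c ≠ 0) (i j : Fin (2 * m)) :
    parityBlocks m r s c i j ≠ 0 ↔ (i = j.rev ∨ i = j) := by
  constructor
  · intro h
    by_contra h'
    rw [not_or] at h'
    exact h (parityBlocks_of_ne r s c h'.2 h'.1)
  · obtain ⟨x, hx0, hx, hx'⟩ := fromCentre_real (c := c) hr (centreDist_lt i)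
    rintro (h | rfl)
    · obtain rfl : j = i.rev := by rw [h, Fin.rev_rev]
      rw [← norm_pos_iff, norm_parityBlocks_rev, hx']
      exact mul_pos (norm_pos_iff.2 hc) hx0
    · rw [parityBlocks_self, hx]
      exact_mod_cast hx0.ne'

theorem fromCentre_zero (s : ℕ → ℂ) (d : ℕ) : fromCentre m s 0 d = 0 := by
  induction d with
  | zero => rfl
  | succ d ih => rw [fromCentre, ih, mul_zero]

theorem parityBlocks_zero_ne_zero_iff {r s : ℕ → ℂ}
    (hr : ∀ k, 1 ≤ k → k < m → r k = (‖s k‖ : ℂ) ∧ s k ≠ 0) (i j : Fin (2 * m)) :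
    parityBlocks m r s 0 i j ≠ 0 ↔ (i = id j ∨ i = j) := by
  rw [id, or_self]
  constructor
  · intro h
    by_contra h'
    by_cases h2 : i = j.rev
    · obtain rfl : j = i.rev := by rw [h2, Fin.rev_rev]
      rw [parityBlocks_rev, fromCentre_zero] at h
      simp at h
    · exact h (parityBlocks_of_ne r s 0 h' h2)
  · rintro rfl
    obtain ⟨x, hx0, hx, -⟩ := fromCentre_real (c := 0) hr (centreDist_lt i)
    rw [parityBlocks_self, hx]
    exact_mod_cast hx0.ne'

/-! ### The nearest-neighbour impurity model -/

theorem div_eq_norm_div {z w : ℂ} (hw : w ≠ 0) (h : w.arg = z.arg) :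
    z / w = ((‖z‖ / ‖w‖ : ℝ) : ℂ) := by
  have hz' := Complex.norm_mul_exp_arg_mul_I z
  have hw' := Complex.norm_mul_exp_arg_mul_I w
  have : (‖w‖ : ℂ) ≠ 0 := by simpa using hw
  rw [div_eq_iff hw, ← hz', ← hw', h]
  simp only [norm_mul, Complex.norm_real, norm_norm, Complex.norm_exp_ofReal_mul_I, mul_one]
  push_cast
  field_simp

theorem star_mul_eq_of_arg_eq {z w : ℂ} (hw : w ≠ 0) (h : w.arg = z.arg) :
    star z * w = star w * z := by
  have e := div_eq_norm_div hw h
  rw [div_eq_iff hw] at e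
  rw [e, star_mul']
  simp only [Complex.star_def, Complex.conj_ofReal]
  ring

/-- PT symmetry: parity exchanges the two impurities and the amplitudes t_k and t_{2m−k}, and
complex conjugation undoes this. -/
theorem nnGamma_rev_rev (t : ℕ → ℂ) {V : Fin (2 * m) → ℝ} (hV : ∀ i, V i.rev = V i) (γ : ℂ)
    (i j : Fin (2 * m)) : nnGamma m t V γ i.rev j.rev = star (nnGamma m t V γ i j) := by
  have hi := i.2
  have hj := j.2
  have a1 : ((i.rev : Fin (2 * m)) : ℕ) + 1 = m ↔ (i : ℕ) = m := by rw [Fin.val_rev]; omega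
  have a2 : ((i.rev : Fin (2 * m)) : ℕ) = m ↔ (i : ℕ) + 1 = m := by rw [Fin.val_rev]; omega
  have a3 : ((j.rev : Fin (2 * m)) : ℕ) = (i.rev : Fin (2 * m)) + 1 ↔ (i : ℕ) = j + 1 := by
    rw [Fin.val_rev, Fin.val_rev]; omega
  have a4 : ((i.rev : Fin (2 * m)) : ℕ) = (j.rev : Fin (2 * m)) + 1 ↔ (j : ℕ) = i + 1 := by
    rw [Fin.val_rev, Fin.val_rev]; omega
  simp only [nnGamma, of_apply, Fin.rev_inj, a1, a2, a3, a4, hV, star_add, apply_ite star,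
    star_zero, star_star]
  have b1 : (i : ℕ) = j + 1 → 2 * m - ((i.rev : Fin (2 * m)) + 1 : ℕ) = j + 1 := by
    rw [Fin.val_rev]; omega
  have b2 : (j : ℕ) = i + 1 → ((j.rev : Fin (2 * m)) + 1 : ℕ) = 2 * m - (i + 1) := by
    rw [Fin.val_rev]; omega
  have c1 : (if (i : ℕ) = j + 1 then star (t (2 * m - ((i.rev : Fin (2 * m)) + 1 : ℕ))) else 0) =
      if (i : ℕ) = j + 1 then star (t (j + 1)) else 0 := by
    split_ifs with h
    · rw [b1 h]
    · rfl
  have c2 : (if (j : ℕ) = i + 1 then t ((j.rev : Fin (2 * m)) + 1 : ℕ) else 0) =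
      if (j : ℕ) = i + 1 then t (2 * m - (i + 1)) else 0 := by
    split_ifs with h
    · rw [b2 h]
    · rfl
  rw [c1, c2]
  simp only [Complex.star_def, Complex.conj_ofReal]
  ring

theorem nnGamma_succ (t : ℕ → ℂ) (V : Fin (2 * m) → ℝ) (γ : ℂ) {i j : Fin (2 * m)}
    (h : (j : ℕ) = i + 1) :
    nnGamma m t V γ i j = star (t (2 * m - (i + 1))) ∧ nnGamma m t V γ j i = t (i + 1) := by
  have h1 : i ≠ j := by rintro rfl; omega
  constructor <;> simp [nnGamma, h1, h1.symm, h] <;> intros <;> omega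

theorem nnGamma_far (t : ℕ → ℂ) (V : Fin (2 * m) → ℝ) (γ : ℂ) {i j : Fin (2 * m)}
    (h0 : i ≠ j) (h1 : (j : ℕ) ≠ i + 1) (h2 : (i : ℕ) ≠ j + 1) : nnGamma m t V γ i j = 0 := by
  simp [nnGamma, h0, h1, h2]

end

/-! ### The metric recurrences and quasi-Hermiticity of the Hamiltonian -/

section

variable {m : ℕ} {t : ℕ → ℂ}

theorem two_mul_sub_ne_zero (ht : ∀ k, 1 ≤ k → k < 2 * m → t k ≠ 0 ∧ (t (2 * m - k)).arg = (t k).arg)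
    {k : ℕ} (h1 : 1 ≤ k) (h2 : k < 2 * m) : t (2 * m - k) ≠ 0 :=
  (ht (2 * m - k) (by omega) (by omega)).1

theorem nnMetric_ratio
    (ht : ∀ k, 1 ≤ k → k < 2 * m → t k ≠ 0 ∧ (t (2 * m - k)).arg = (t k).arg) :
    ∀ k, 1 ≤ k → k < m → t k / t (2 * m - k) = (‖star (t k) / t (2 * m - k)‖ : ℂ) ∧
      star (t k) / t (2 * m - k) ≠ 0 := by
  intro k h1 h2
  obtain ⟨h, ha⟩ := ht k h1 (by omega)
  have h' := two_mul_sub_ne_zero ht h1 (by omega)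
  refine ⟨?_, div_ne_zero (star_ne_zero.2 h) h'⟩
  rw [div_eq_norm_div h' ha, norm_div, norm_star]

theorem nnMetricInv_ratio
    (ht : ∀ k, 1 ≤ k → k < 2 * m → t k ≠ 0 ∧ (t (2 * m - k)).arg = (t k).arg) :
    ∀ k, 1 ≤ k → k < m → t (2 * m - k) / t k = (‖t (2 * m - k) / star (t k)‖ : ℂ) ∧
      t (2 * m - k) / star (t k) ≠ 0 := by
  intro k h1 h2
  obtain ⟨h, ha⟩ := ht k h1 (by omega)
  have h' := two_mul_sub_ne_zero ht h1 (by omega)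
  refine ⟨?_, div_ne_zero h' (star_ne_zero.2 h)⟩
  rw [div_eq_norm_div h ha.symm, norm_div, norm_star]

theorem normSq_centre (γ : ℂ) (β : ℝ) :
    ‖(β : ℂ) - Complex.I * (γ.im : ℂ)‖ ^ 2 = β ^ 2 + γ.im ^ 2 := by
  rw [← Complex.normSq_eq_norm_sq, Complex.normSq_apply]
  simp
  ring

theorem norm_centre_lt_one {γ : ℂ} {β : ℝ} {z : ℂ} (hz : z ≠ 0)
    (h : β ^ 2 + γ.im ^ 2 < ‖z‖ ^ 2) : ‖((β : ℂ) - Complex.I * (γ.im : ℂ)) / z‖ < 1 := by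
  rw [norm_div, div_lt_one (norm_pos_iff.2 hz)]
  rw [← normSq_centre] at h
  exact lt_of_pow_lt_pow_left₀ 2 (norm_nonneg _) h

theorem centre_ne_zero {γ : ℂ} {β : ℝ} {z : ℂ} (hz : z ≠ 0) (h : γ.im ≠ 0 ∨ β ≠ 0) :
    ((β : ℂ) - Complex.I * (γ.im : ℂ)) / z ≠ 0 := by
  refine div_ne_zero ?_ hz
  rw [← norm_ne_zero_iff, ← pow_ne_zero_iff two_ne_zero, normSq_centre]
  rcases h with h | h <;> positivity

/-- The diagonal recurrence makes the hopping balanced. Off the centre this uses that t_k and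
t_{2m−k} have equal arguments; at the central bond the two diagonal entries coincide. -/
theorem nnMetric_self_succ (γ : ℂ) (β : ℝ) (V : Fin (2 * m) → ℝ)
    (ht : ∀ k, 1 ≤ k → k < 2 * m → t k ≠ 0 ∧ (t (2 * m - k)).arg = (t k).arg)
    {i j : Fin (2 * m)} (h : (j : ℕ) = i + 1) :
    nnMetric m t γ β i i * nnGamma m t V γ i j =
      star (nnGamma m t V γ j i) * nnMetric m t γ β j j := by
  have hj := j.2
  obtain ⟨g1, g2⟩ := nnGamma_succ t V γ h
  rw [g1, g2, nnMetric, parityBlocks_self, parityBlocks_self]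
  rcases lt_trichotomy ((i : ℕ) + 1) m with hi | hi | hi
  · have e : centreDist m i = centreDist m j + 1 := by
      rw [centreDist, centreDist, if_pos (by omega), if_pos (by omega)]; omega
    have e' : m - (centreDist m j + 1) = i + 1 := by
      rw [centreDist, if_pos (by omega)]; omega
    have hK := star_mul_eq_of_arg_eq (two_mul_sub_ne_zero ht (k := i + 1) (by omega) (by omega))
      (ht (i + 1) (by omega) (by omega)).2
    have h0 := two_mul_sub_ne_zero ht (k := i + 1) (by omega) (by omega)
    rw [e, fromCentre, e']
    field_simp
    linear_combination -(fromCentre m (fun k => t k / t (2 * m - k)) 1 (centreDist m j)) * hK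
  · have e : centreDist m i = centreDist m j := by
      rw [centreDist, centreDist, if_pos (by omega), if_neg (by omega)]; omega
    have e' : 2 * m - ((i : ℕ) + 1) = i + 1 := by omega
    rw [e, e', mul_comm]
  · have e : centreDist m j = centreDist m i + 1 := by
      rw [centreDist, centreDist, if_neg (by omega), if_neg (by omega)]; omega
    have e' : m - (centreDist m i + 1) = 2 * m - (i + 1) := by
      rw [centreDist, if_neg (by omega)]; omega
    have e'' : 2 * m - (2 * m - ((i : ℕ) + 1)) = i + 1 := by omega
    have h0 := (ht (i + 1) (by omega) (by omega)).1
    have hK := star_mul_eq_of_arg_eq (two_mul_sub_ne_zero ht (k := i + 1) (by omega) (by omega))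
      (ht (i + 1) (by omega) (by omega)).2
    rw [e, fromCentre, e', e'']
    field_simp
    linear_combination -(fromCentre m (fun k => t k / t (2 * m - k)) 1 (centreDist m i)) * hK

/-- The off-diagonal recurrence cancels both terms except at the central bond, where conj(c t_m) − c
t_m = 2i Im γ for c = (β − i Im γ)/t_m. The choice of c is made for this; β drops out. -/
theorem nnMetric_rev_succ (γ : ℂ) (β : ℝ) (V : Fin (2 * m) → ℝ)
    (ht : ∀ k, 1 ≤ k → k < 2 * m → t k ≠ 0 ∧ (t (2 * m - k)).arg = (t k).arg)
    {i j : Fin (2 * m)} (h : (j : ℕ) = i + 1) :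
    star (nnMetric m t γ β i i.rev) * nnGamma m t V γ i j -
      nnGamma m t V γ j i * star (nnMetric m t γ β j j.rev) =
      if (j : ℕ) = m then 2 * Complex.I * γ.im else 0 := by
  have hj := j.2
  obtain ⟨g1, g2⟩ := nnGamma_succ t V γ h
  rw [g1, g2, nnMetric, parityBlocks_rev, parityBlocks_rev]
  rcases lt_trichotomy ((i : ℕ) + 1) m with hi | hi | hi
  · have e : centreDist m i = centreDist m j + 1 := by
      rw [centreDist, centreDist, if_pos (by omega), if_pos (by omega)]; omega
    have e' : m - (centreDist m j + 1) = i + 1 := by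
      rw [centreDist, if_pos (by omega)]; omega
    have h0 : star (t (2 * m - (i + 1))) ≠ 0 :=
      star_ne_zero.2 (two_mul_sub_ne_zero ht (k := i + 1) (by omega) (by omega))
    rw [if_pos (by omega), if_pos (by omega), if_neg (by omega), e, fromCentre, e', star_mul',
      star_div₀, star_star]
    field_simp
    ring
  · have e : centreDist m i = 0 := by
      rw [centreDist, if_pos (by omega)]; omega
    have e1 : centreDist m j = 0 := by
      rw [centreDist, if_neg (by omega)]; omega
    have e' : 2 * m - ((i : ℕ) + 1) = m := by omega
    have h0 := (ht m (by omega) (by omega)).1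
    have h0' : star (t m) ≠ 0 := star_ne_zero.2 h0
    rw [if_pos (by omega), if_neg (by omega), if_pos (by omega), e, e1, e', hi, star_star,
      fromCentre, star_div₀, div_mul_cancel₀ _ h0', mul_div_cancel₀ _ h0]
    simp
    ring
  · have e : centreDist m j = centreDist m i + 1 := by
      rw [centreDist, centreDist, if_neg (by omega), if_neg (by omega)]; omega
    have e' : m - (centreDist m i + 1) = 2 * m - (i + 1) := by
      rw [centreDist, if_neg (by omega)]; omega
    have e'' : 2 * m - (2 * m - ((i : ℕ) + 1)) = i + 1 := by omega
    have h0 := (ht (i + 1) (by omega) (by omega)).1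
    rw [if_neg (by omega), if_neg (by omega), if_neg (by omega), e, fromCentre, e', e'', star_star,
      star_star]
    field_simp
    ring

theorem nnGamma_self (V : Fin (2 * m) → ℝ) (γ : ℂ) (i : Fin (2 * m)) :
    nnGamma m t V γ i i - star (nnGamma m t V γ i i) =
      if (i : ℕ) + 1 = m then 2 * Complex.I * γ.im
      else if (i : ℕ) = m then -(2 * Complex.I * γ.im) else 0 := by
  have h : ¬ ((i : ℕ) + 1 = m ∧ (i : ℕ) = m) := by omega
  apply Complex.ext <;> by_cases h1 : (i : ℕ) + 1 = m <;> by_cases h2 : (i : ℕ) = m <;>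
    simp [nnGamma, h1, h2] <;> first | omega | ring

theorem nnMetric_self (γ : ℂ) (β : ℝ) (V : Fin (2 * m) → ℝ)
    (ht : ∀ k, 1 ≤ k → k < 2 * m → t k ≠ 0 ∧ (t (2 * m - k)).arg = (t k).arg)
    (i j : Fin (2 * m)) :
    nnMetric m t γ β i i * nnGamma m t V γ i j -
      star (nnGamma m t V γ j i) * nnMetric m t γ β j j =
      if i = j then (if (i : ℕ) + 1 = m then 2 * Complex.I * γ.im
      else if (i : ℕ) = m then -(2 * Complex.I * γ.im) else 0) else 0 := by
  have hH := parityBlocks_isHermitian (nnMetric_ratio ht)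
    (c := ((β : ℂ) - Complex.I * (γ.im : ℂ)) / t m)
  by_cases hij : i = j
  · subst hij
    rw [mul_comm, ← sub_mul, nnGamma_self, if_pos rfl]
    have h1 : ((i : ℕ) + 1 = m ∨ (i : ℕ) = m) → nnMetric m t γ β i i = 1 := by
      intro h
      have : centreDist m i = 0 := by rw [centreDist]; split_ifs <;> omega
      rw [nnMetric, parityBlocks_self, this, fromCentre]
    split_ifs with h2 h3
    · rw [h1 (Or.inl h2), mul_one]
    · rw [h1 (Or.inr h3), mul_one]
    · rw [zero_mul]
  rw [if_neg hij]
  by_cases h1 : (j : ℕ) = i + 1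
  · rw [nnMetric_self_succ γ β V ht h1, sub_self]
  by_cases h2 : (i : ℕ) = j + 1
  · have := congrArg star (nnMetric_self_succ γ β V ht h2)
    rw [star_mul', star_mul', star_star, nnMetric, hH.apply, hH.apply] at this
    rw [nnMetric, mul_comm, ← this, mul_comm, sub_self]
  · rw [nnGamma_far t V γ hij h1 h2, nnGamma_far t V γ (Ne.symm hij) h2 h1]
    simp

theorem nnMetric_rev (γ : ℂ) (β : ℝ) (V : Fin (2 * m) → ℝ)
    (ht : ∀ k, 1 ≤ k → k < 2 * m → t k ≠ 0 ∧ (t (2 * m - k)).arg = (t k).arg)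
    (i j : Fin (2 * m)) :
    star (nnMetric m t γ β i i.rev) * nnGamma m t V γ i j -
      nnGamma m t V γ j i * star (nnMetric m t γ β j j.rev) =
      if i = j.rev then (if (j : ℕ) + 1 = m then -(2 * Complex.I * γ.im)
      else if (j : ℕ) = m then 2 * Complex.I * γ.im else 0) else 0 := by
  have hrev : i = j.rev ↔ (i : ℕ) = 2 * m - (j + 1) := by rw [Fin.ext_iff, Fin.val_rev]
  have hj := j.2
  have hi := i.2
  by_cases h1 : (j : ℕ) = i + 1
  · rw [nnMetric_rev_succ γ β V ht h1]
    simp only [hrev]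
    split_ifs <;> first | omega | rfl
  by_cases h2 : (i : ℕ) = j + 1
  · have := nnMetric_rev_succ γ β V ht h2
    -- The left side is antisymmetric under exchange of i and j.
    have e : star (nnMetric m t γ β i i.rev) * nnGamma m t V γ i j -
        nnGamma m t V γ j i * star (nnMetric m t γ β j j.rev) =
        -(if (i : ℕ) = m then 2 * Complex.I * γ.im else 0) := by
      linear_combination -this
    rw [e]
    simp only [hrev]
    split_ifs <;> first | omega | rfl | simp
  · have h3 : star (nnMetric m t γ β i i.rev) * nnGamma m t V γ i j -
      nnGamma m t V γ j i * star (nnMetric m t γ β j j.rev) = 0 := by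
      by_cases hij : i = j
      · subst hij; ring
      · rw [nnGamma_far t V γ hij h1 h2, nnGamma_far t V γ (Ne.symm hij) h2 h1]
        simp
    rw [h3]
    simp only [hrev]
    split_ifs <;> first | omega | rfl

theorem parityBlocks_mul (r s : ℕ → ℂ) (c : ℂ) (G : Matrix (Fin (2 * m)) (Fin (2 * m)) ℂ)
    (i j : Fin (2 * m)) :
    (parityBlocks m r s c * G) i j =
      parityBlocks m r s c i i * G i j + parityBlocks m r s c i i.rev * G i.rev j := by
  rw [Matrix.mul_apply, ← Finset.sum_subset (Finset.subset_univ {i, i.rev}),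
    Finset.sum_pair (rev_ne i).symm]
  intro k _ hk
  simp only [Finset.mem_insert, Finset.mem_singleton, not_or] at hk
  rw [parityBlocks_of_ne r s c (Ne.symm hk.1), zero_mul]
  rintro rfl
  simp at hk

/-- The claim is that the product of metric and Hamiltonian is Hermitian. By PT symmetry its
anti-Hermitian defect at (i, j) splits into a diagonal part (`nnMetric_self` at i, j) and a parity
part (`nnMetric_rev` at `i.rev`, j), which survive only on the impurities and with opposite signs.
-/
theorem nnMetric_mul_nnGamma (γ : ℂ) (β : ℝ) {V : Fin (2 * m) → ℝ} (hV : ∀ i, V i.rev = V i)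
    (ht : ∀ k, 1 ≤ k → k < 2 * m → t k ≠ 0 ∧ (t (2 * m - k)).arg = (t k).arg) :
    nnMetric m t γ β * nnGamma m t V γ = (nnGamma m t V γ)ᴴ * nnMetric m t γ β := by
  have hH : (nnMetric m t γ β).IsHermitian := parityBlocks_isHermitian (nnMetric_ratio ht)
  have hmul : ∀ i j, (nnMetric m t γ β * nnGamma m t V γ) i j =
      nnMetric m t γ β i i * nnGamma m t V γ i j +
        nnMetric m t γ β i i.rev * nnGamma m t V γ i.rev j := parityBlocks_mul _ _ _ _
  have hadj : (nnGamma m t V γ)ᴴ * nnMetric m t γ β =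
      (nnMetric m t γ β * nnGamma m t V γ)ᴴ := by rw [conjTranspose_mul, hH.eq]
  ext i j
  rw [hadj, conjTranspose_apply, hmul, hmul, star_add, star_mul', star_mul', hH.apply j j,
    ← nnGamma_rev_rev t hV γ j.rev i, Fin.rev_rev]
  have hA := nnMetric_self γ β V ht i j
  have hB := nnMetric_rev γ β V ht i.rev j
  rw [Fin.rev_rev, hH.apply i i.rev] at hB
  have hAB : ∀ x : ℂ, (if i = j then (if (i : ℕ) + 1 = m then x
      else if (i : ℕ) = m then -x else 0) else 0) +
      (if i.rev = j.rev then (if (j : ℕ) + 1 = m then -x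
      else if (j : ℕ) = m then x else 0) else 0) = 0 := by
    intro x
    simp only [Fin.rev_inj]
    by_cases hij : i = j
    · subst hij; simp only [if_true]; split_ifs <;> simp
    · simp [hij]
  have := hAB (2 * Complex.I * γ.im)
  rw [← hA, ← hB] at this
  linear_combination this

theorem parityBlocks_locality {r s : ℕ → ℂ} {c : ℂ} {p : Prop}
    (hr : ∀ k, 1 ≤ k → k < m → r k = (‖s k‖ : ℂ) ∧ s k ≠ 0) (hc : ‖c‖ < 1)
    (hp : p → c ≠ 0) (hp' : ¬ p → c = 0) :
    (parityBlocks m r s c).PosDef ∧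
    (∃! η : Op (2 * m), IsTotalMetric (parityBlocks m r s c) η) ∧
    ∀ η : Op (2 * m), IsTotalMetric (parityBlocks m r s c) η →
      (p → ∀ A : Finset (Fin (2 * m)),
        (HasExtensivelyLocalObservable η A ↔ A.image Fin.rev = A)) ∧
      (¬ p → ∀ A : Finset (Fin (2 * m)), HasExtensivelyLocalObservable η A) := by
  have hM := parityBlocks_posDef hr hc
  refine ⟨hM, existsUnique_isTotalMetric _, fun η h => ⟨fun hq A => ?_, fun hq A => ?_⟩⟩
  · exact hasExtensivelyLocalObservable_iff h hM Fin.rev_involutive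
      (parityBlocks_ne_zero_iff hr (hp hq)) A
  -- With c = 0 the metric is diagonal, so the involution is the identity and every subsystem is
  -- invariant.
  · obtain rfl := hp' hq
    exact (hasExtensivelyLocalObservable_iff h hM (f := id) (fun _ => rfl)
      (parityBlocks_zero_ne_zero_iff hr) A).2 Finset.image_id

end

end FreeFermion

theorem corollary5 :
    (∀ (n : ℕ) (M : Matrix (Fin n) (Fin n) ℂ) (f : Fin n → Fin n),
      M.PosDef → Function.Involutive f →
      (∀ i j, M i j ≠ 0 ↔ (i = f j ∨ i = j)) →
      (∃! η : Op n, IsTotalMetric M η) ∧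
      ∀ η : Op n, IsTotalMetric M η →
        η.PosDef ∧
        ∀ A : Finset (Fin n),
          (HasExtensivelyLocalObservable η A ↔ A.image f = A) ∧
          (A.image f = A → ∀ O : Op n,
            (IsBKLocal A O ∧ IsObservable η O) ↔
              ∃ c : Finset (Fin n) → Finset (Fin n) → ℂ,
                (∀ S₁ S₂, c S₁ S₂ = star (c S₂ S₁)) ∧
                (∀ S₁ S₂, Odd (S₁.card + S₂.card) → c S₁ S₂ = 0) ∧
                O = generalLocal M A c)) ∧
    (∀ (m : ℕ) (t : ℕ → ℂ) (V : Fin (2 * m) → ℝ) (γ : ℂ) (β : ℝ),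
      1 ≤ m →
      (∀ k, 1 ≤ k → k < 2 * m → t k ≠ 0 ∧ (t (2 * m - k)).arg = (t k).arg) →
      (∀ i, V i.rev = V i) →
      β ^ 2 + γ.im ^ 2 < ‖t m‖ ^ 2 →
      (∀ η, IsTotalMetric (nnMetric m t γ β) η → IsObservable η (nnHamiltonian m t V γ)) ∧
      ∀ M : Matrix (Fin (2 * m)) (Fin (2 * m)) ℂ,
        (M = nnMetric m t γ β ∨ M = nnMetricInv m t γ β) →
        M.PosDef ∧
        (∃! η : Op (2 * m), IsTotalMetric M η) ∧
        ∀ η : Op (2 * m), IsTotalMetric M η →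
          ((γ.im ≠ 0 ∨ β ≠ 0) → ∀ A : Finset (Fin (2 * m)),
            (HasExtensivelyLocalObservable η A ↔ A.image Fin.rev = A)) ∧
          ((γ.im = 0 ∧ β = 0) → ∀ A : Finset (Fin (2 * m)),
            HasExtensivelyLocalObservable η A)) := by
  refine ⟨fun n M f hM hf hMf => ⟨existsUnique_isTotalMetric M, fun η h => ⟨h.posDef hM, fun A =>
    ⟨hasExtensivelyLocalObservable_iff h hM hf hMf A,
      fun hA => isBKLocal_and_isObservable_iff_of_involutive h hM hf hMf hA⟩⟩⟩,
    fun m t V γ β hm ht hV hβ => ⟨fun η h => ?_, ?_⟩⟩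
  · exact h.isObservable_quadratic (parityBlocks_isHermitian (nnMetric_ratio ht))
      (nnMetric_mul_nnGamma γ β hV ht)
  · have h0 := (ht m hm (by omega)).1
    have hc := norm_centre_lt_one h0 hβ
    have hp' : ¬ (γ.im ≠ 0 ∨ β ≠ 0) → ((β : ℂ) - Complex.I * (γ.im : ℂ)) / t m = 0 := by
      intro h
      rw [not_or, not_not, not_not] at h
      simp [h.1, h.2]
    have hiff : (γ.im = 0 ∧ β = 0) ↔ ¬ (γ.im ≠ 0 ∨ β ≠ 0) := by
      rw [not_or, not_not, not_not]
    simp only [hiff]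
    rintro M (rfl | rfl)
    · exact parityBlocks_locality (nnMetric_ratio ht) hc (centre_ne_zero h0) hp'
    · exact parityBlocks_locality (nnMetricInv_ratio ht) hc (centre_ne_zero h0) hp'
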